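/- A directed graph is a finite set $V$ of vertices together with a set $E\subseteq V\times V$ of edges. Let $G=(V,E)$ be a directed graph and let $P\subseteq V\times V$ be a set of vertex pairs. A $2$-fault-tolerant reachability preserver of $G$ for $P$ is a subgraph $H=(V,E_H)$ of $G$, $E_H\subseteq E$, such that for every pair $(s,t)\in P$ and every set $F\subseteq E$ of at most two edges, $t$ is reachable from $s$ in $G\setminus F$ if and only if $t$ is reachable from $s$ in $H\setminus F$ (where $\setminus F$ means that the edges of $F$ are deleted). Theorem. There is an absolute constant $C$ such that for every directed graph $G$ with $n$ vertices and every set $P$ of pairs of its vertices there is a $2$-fault-tolerant reachability preserver of $G$ for $P$ with at most $C\,n^{4/3}\,|P|^{1/3}$ edges. Furthermore, such a preserver can be found by a deterministic algorithm in polynomial time: there are a program $A$ of a random access machine (unit-cost addition, subtraction, comparison and memory access, no multiplication) and a polynomial $p$ such that for all $n$, every directed graph $G$ on the vertices $0,\dots,n-1$ and every set $P$ of pairs of vertices, $A$, started with $n$, the adjacency matrix of $G$ and the indicator matrix of $P$ in its memory, halts after at most $p(n)$ steps, and its memory then holds the adjacency matrix of a $2$-fault-tolerant reachability preserver of $G$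 for $P$ with at most $C\,n^{4/3}\,|P|^{1/3}$ edges. -/

import Mathlib

namespace FTRS

section Graphs

variable {V : Type*}

/-- The set of edges of a digraph, as ordered pairs of vertices. -/
def edges (G : Digraph V) : Set (V × V) := {e | G.Adj e.1 e.2}

/-- The digraph obtained from `G` by deleting the edges in `F`. -/
def deleteEdges (G : Digraph V) (F : Set (V × V)) : Digraph V where
  Adj u v := G.Adj u v ∧ (u, v) ∉ F

/-- There is a directed path (possibly of length zero) from `s` to `t` in `G`. -/
def Reachable (G : Digraph V) (s t : V) : Prop := Relation.ReflTransGen G.Adj s t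

/-- `H` is a `k`-fault-tolerant reachability subgraph of `G` for the set `P` of vertex pairs:
a subgraph of `G` that preserves the reachability of every pair of `P` under the failure of at
most `k` edges of `G`. -/
def IsFTRS (k : ℕ) (G : Digraph V) (P : Finset (V × V)) (H : Digraph V) : Prop :=
  H ≤ G ∧ ∀ s t : V, (s, t) ∈ P → ∀ F : Finset (V × V), (F : Set (V × V)) ⊆ edges G → F.card ≤ k →
    (Reachable (deleteEdges G F) s t ↔ Reachable (deleteEdges H F) s t)

end Graphs

namespace RAM

/-! A deterministic random access machine with a structured programming language. A memory
consists of registers, and of two-dimensional arrays; each register and each array cell holds a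
natural number. The elementary operations, each of which costs one time step, are producing a
constant, reading or writing a register or an array cell, addition, truncated subtraction,
comparison, branching on a value, and the empty command. There is no multiplication, so that the length of a number grows at most linearly with the number of
steps, and polynomial time on this machine is polynomial time on a Turing machine. -/

/-- The contents of the memory: `reg x` is the content of the register `x`, and `arr a i j` is the
entry in row `i` and column `j` of the array `a`. -/
structure State where
  reg : ℕ → ℕ
  arr : ℕ → ℕ → ℕ → ℕ

/-- Expressions over the memory. -/
inductive Expr : Type
  /-- a constant -/
  | const (c : ℕ)
  /-- the content of the register `x` -/
  | reg (x : ℕ)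
  /-- the cell of the array `a` whose row and column are given by the two expressions -/
  | cell (a : ℕ) (i j : Expr)
  /-- addition -/
  | add (e f : Expr)
  /-- truncated subtraction -/
  | sub (e f : Expr)
  /-- `1` if the two values are equal, and `0` otherwise -/
  | eq (e f : Expr)
  /-- `1` if the first value is smaller than the second one, and `0` otherwise -/
  | lt (e f : Expr)

/-- The value of an expression. -/
def Expr.eval (σ : State) : Expr → ℕ
  | .const c => c
  | .reg x => σ.reg x
  | .cell a i j => σ.arr a (i.eval σ) (j.eval σ)
  | .add e f => e.eval σ + f.eval σ
  | .sub e f => e.eval σ - f.eval σ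
  | .eq e f => if e.eval σ = f.eval σ then 1 else 0
  | .lt e f => if e.eval σ < f.eval σ then 1 else 0

/-- The number of steps of the evaluation of an expression: one for each operation in it. -/
def Expr.cost : Expr → ℕ
  | .const _ => 1
  | .reg _ => 1
  | .cell _ i j => i.cost + j.cost + 1
  | .add e f => e.cost + f.cost + 1
  | .sub e f => e.cost + f.cost + 1
  | .eq e f => e.cost + f.cost + 1
  | .lt e f => e.cost + f.cost + 1

/-- Programs. -/
inductive Program : Type
  /-- do nothing -/
  | skip
  /-- write the value of `e` into the register `x` -/
  | assign (x : ℕ) (e : Expr)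
  /-- write the value of `e` into the cell `(i, j)` of the array `a` -/
  | store (a : ℕ) (i j e : Expr)
  /-- run `p`, then `q` -/
  | seq (p q : Program)
  /-- run `p` if the value of `e` is nonzero, and `q` otherwise -/
  | cond (e : Expr) (p q : Program)
  /-- as long as the value of `e` is nonzero, run `p` -/
  | loop (e : Expr) (p : Program)

/-- Overwrite the register `x` by `v`. -/
def State.setReg (σ : State) (x v : ℕ) : State where
  reg y := if y = x then v else σ.reg y
  arr := σ.arr

/-- Overwrite the cell `(i, j)` of the array `a` by `v`. -/
def State.setCell (σ : State) (a i j v : ℕ) : State where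
  reg := σ.reg
  arr b k l := if b = a ∧ k = i ∧ l = j then v else σ.arr b k l

/-- `Exec p σ T τ`: started with the memory `σ`, the program `p` halts after exactly `T` steps,
with the memory `τ`. -/
inductive Exec : Program → State → ℕ → State → Prop
  | skip (σ : State) : Exec .skip σ 1 σ
  | assign (σ : State) (x : ℕ) (e : Expr) :
      Exec (.assign x e) σ (e.cost + 1) (σ.setReg x (e.eval σ))
  | store (σ : State) (a : ℕ) (i j e : Expr) :
      Exec (.store a i j e) σ (i.cost + j.cost + e.cost + 1)
        (σ.setCell a (i.eval σ) (j.eval σ) (e.eval σ))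
  | seq {p q : Program} {σ τ ρ : State} {S T : ℕ} :
      Exec p σ S τ → Exec q τ T ρ → Exec (.seq p q) σ (S + T) ρ
  | cond_true {e : Expr} {p q : Program} {σ τ : State} {T : ℕ} :
      e.eval σ ≠ 0 → Exec p σ T τ → Exec (.cond e p q) σ (e.cost + 1 + T) τ
  | cond_false {e : Expr} {p q : Program} {σ τ : State} {T : ℕ} :
      e.eval σ = 0 → Exec q σ T τ → Exec (.cond e p q) σ (e.cost + 1 + T) τ
  | loop_true {e : Expr} {p : Program} {σ τ ρ : State} {S T : ℕ} :
      e.eval σ ≠ 0 → Exec p σ S τ → Exec (.loop e p) τ T ρ →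
        Exec (.loop e p) σ (e.cost + 1 + S + T) ρ
  | loop_false {e : Expr} {p : Program} {σ : State} :
      e.eval σ = 0 → Exec (.loop e p) σ (e.cost + 1) σ

end RAM

open Classical in
/-- The initial memory for a digraph `G` on the vertices `0, …, n - 1` and a set `P` of vertex
pairs: the register `0` holds `n`, the array `0` holds the adjacency matrix of `G`, and the
array `1` holds the indicator matrix of `P`. All the rest is `0`. -/
noncomputable def inputState {n : ℕ} (G : Digraph (Fin n)) (P : Finset (Fin n × Fin n)) :
    RAM.State where
  reg x := if x = 0 then n else 0
  arr a i j :=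
    if h : i < n ∧ j < n then
      if a = 0 ∧ G.Adj ⟨i, h.1⟩ ⟨j, h.2⟩ ∨ a = 1 ∧ (⟨i, h.1⟩, ⟨j, h.2⟩) ∈ P then 1 else 0
    else 0

/-- The digraph on the vertices `0, …, n - 1` whose adjacency matrix is in the array `2`; a nonzero
entry stands for an edge. -/
def outputGraph (n : ℕ) (σ : RAM.State) : Digraph (Fin n) where
  Adj u v := σ.arr 2 u v ≠ 0

end FTRS

/-! A preserver from which no edge can be deleted is small, and reverse deletion computes such a
preserver; so the theorem rests on one count. In a minimal preserver with edge set `E` every edge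
`e` is `Critical` for some pair `(s, t)` of `P` and some set `F` of at most two faults: `E \ F`
leads from `s` to `t`, but only through `e`.

The count has three ingredients. For a fixed source, or a fixed target, at most `9 n` edges are
critical (`card_critical_source_le`, `card_critical_target_le`), by submodularity of cuts. If `t` is
reachable from `s`, there are two paths that share only bridges (`Reach.exists_two_routes`), and one
of them survives any single fault that leaves `t` reachable. Finally, few vertices hit long paths
(`exists_short_prefixes`, `exists_hitting_set`).

They are combined in `card_le_of_critical`, for `r ^ 3 ≥ n |P|`. A set `R₁` of at most `r` vertices
leaves in total at most `2 r ^ 2` edges near the ends of the first paths, before or after all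
vertices of `R₁`. Each pair gets a list of candidate paths: the two paths in `E`, the two after
deletion of any one end edge, and the two after deletion of all middle edges of the first path.
There are at most `8 r ^ 2` candidates, so at most `8 r` vertices `R₂` hit all of them but some of
total size `n r`. Now let `e` be critical for `(s, t)` and `F`. If a vertex of `R₁ ∪ R₂` lies on a
walk from `s` to `t` in `E \ F`, then `e` is critical from or to that vertex, which accounts for `9
r * 18 n` edges. Otherwise some candidate survives `F`; it contains `e` and is not hit by `R₂`,
which accounts for `n r` more.

For the algorithm, deleting further edges never repairs a violated pair, so an edge once found
indispensable remains so, and a single pass over the edges ends with a minimal preserver. The test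
runs through all codes of two faults and all sources, and computes reachability by repeated
relaxation. -/

namespace FTRS

/-! ### Paths, and two paths that share only bridges. -/

section Routes

open Relation

/-- A relation that leads from inside a set to outside of it has a step that leaves the set. -/
theorem exists_exit_of_reflTransGen {α : Type*} {r : α → α → Prop} {s t : α}
    (h : ReflTransGen r s t) {X : Set α} (hs : s ∈ X) (ht : t ∉ X) :
    ∃ u v, r u v ∧ u ∈ X ∧ v ∉ X ∧ ReflTransGen r v t := by
  induction h using ReflTransGen.head_induction_on with
  | refl => exact absurd hs ht
  | @head a b hab hbt ih =>
    by_cases hb : b ∈ X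
    · exact ih hb
    · exact ⟨a, b, hab, hs, hb, hbt⟩

/-- Two related elements are joined by a sequence without repetitions. -/
theorem exists_injOn_of_reflTransGen {α : Type*} {r : α → α → Prop} {s t : α}
    (h : ReflTransGen r s t) :
    ∃ (l : ℕ) (x : ℕ → α), x 0 = s ∧ x l = t ∧ (∀ i < l, r (x i) (x (i + 1))) ∧
      Set.InjOn x (Set.Iic l) := by
  have hex : ∃ (l : ℕ) (x : ℕ → α), x 0 = s ∧ x l = t ∧ (∀ i < l, r (x i) (x (i + 1))) := by
    induction h using ReflTransGen.head_induction_on with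
    | refl => exact ⟨0, fun _ => t, rfl, rfl, by simp⟩
    | @head a b hab _ ih =>
      obtain ⟨l, x, h0, hl, hx⟩ := ih
      refine ⟨l + 1, fun i => if i = 0 then a else x (i - 1), by simp, by simpa using hl, ?_⟩
      rintro (_ | i) hi
      · simpa [h0] using hab
      · simpa using hx i (by omega)
  classical
  obtain ⟨x, h0, hl, hx⟩ := Nat.find_spec hex
  refine ⟨Nat.find hex, x, h0, hl, hx, ?_⟩
  set l := Nat.find hex with hl_def
  -- In a shortest sequence no element repeats, since the part between two equal elements could be
  -- cut out.
  have key : ∀ i j, i < j → j ≤ l → x i ≠ x j := by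
    intro i j hij hj hxij
    have hlt : l - (j - i) < Nat.find hex := by omega
    refine Nat.find_min hex hlt ⟨fun k => if k ≤ i then x k else x (k + (j - i)), by simpa using h0,
      ?_, ?_⟩
    · by_cases hc : l - (j - i) ≤ i
      · have hjl : j = l := by omega
        have : l - (j - i) = i := by omega
        simp only [hc, if_true]
        rw [this, hxij, hjl, hl]
      · simp only [hc, if_false]
        rw [show l - (j - i) + (j - i) = l by omega, hl]
    · intro k hk
      by_cases h1 : k + 1 ≤ i
      · simpa [h1, show k ≤ i by omega] using hx k (by omega)
      · by_cases h2 : k ≤ i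
        · have hki : k = i := by omega
          simp only [h2, h1, if_true, if_false]
          rw [hki, hxij, show i + 1 + (j - i) = j + 1 by omega]
          exact hx j (by omega)
        · simp only [h2, h1, if_false]
          rw [show k + 1 + (j - i) = k + (j - i) + 1 by omega]
          exact hx _ (by omega)
  intro i hi j hj hij
  rcases lt_trichotomy i j with h | h | h
  · exact absurd hij (key i j h hj)
  · exact h
  · exact absurd hij.symm (key j i h hi)

variable {V : Type*}

/-- There is a directed path from `s` to `t` all of whose edges are in `E`. -/
def Reach (E : Finset (V × V)) (s t : V) : Prop := ReflTransGen (fun u v => (u, v) ∈ E) s t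

theorem Reach.refl (E : Finset (V × V)) (s : V) : Reach E s s := ReflTransGen.refl

theorem Reach.single {E : Finset (V × V)} {e : V × V} (h : e ∈ E) : Reach E e.1 e.2 :=
  ReflTransGen.single h

theorem Reach.trans {E : Finset (V × V)} {s t u : V} (h : Reach E s t) (h' : Reach E t u) :
    Reach E s u := ReflTransGen.trans h h'

theorem Reach.mono {E E' : Finset (V × V)} {s t : V} (h : Reach E s t) (hE : E ⊆ E') :
    Reach E' s t := ReflTransGen.mono (fun _ _ h => hE h) _ _ h

/-- A finite sequence of vertices. -/
structure Route (V : Type*) where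
  len : ℕ
  vtx : ℕ → V

namespace Route

/-- The route is a path from `s` to `t` without repeated vertices, with edges in `E`. -/
structure IsPath (p : Route V) (E : Finset (V × V)) (s t : V) : Prop where
  source : p.vtx 0 = s
  target : p.vtx p.len = t
  mem : ∀ i < p.len, (p.vtx i, p.vtx (i + 1)) ∈ E
  inj : Set.InjOn p.vtx (Set.Iic p.len)

theorem reach_of_mem {p : Route V} {E : Finset (V × V)} {i j : ℕ} (hij : i ≤ j)
    (h : ∀ k, i ≤ k → k < j → (p.vtx k, p.vtx (k + 1)) ∈ E) :
    Reach E (p.vtx i) (p.vtx j) := by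
  induction j, hij using Nat.le_induction with
  | base => exact Reach.refl _ _
  | succ j hij ih =>
    exact (ih fun k h1 h2 => h k h1 (by omega)).trans
      (Reach.single (e := (p.vtx j, p.vtx (j + 1))) (h j hij (by omega)))

theorem IsPath.reach {p : Route V} {E : Finset (V × V)} {s t : V} (h : p.IsPath E s t) :
    Reach E s t := by
  rw [← h.source, ← h.target]
  exact reach_of_mem (Nat.zero_le _) fun k _ hk => h.mem k hk

theorem IsPath.index_unique {p : Route V} {E : Finset (V × V)} {s t : V} (h : p.IsPath E s t)
    {i j : ℕ} (hi : i ≤ p.len) (hj : j ≤ p.len) (hij : p.vtx i = p.vtx j) : i = j :=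
  h.inj hi hj hij

end Route

theorem Reach.exists_route {E : Finset (V × V)} {s t : V} (h : Reach E s t) :
    ∃ p : Route V, p.IsPath E s t := by
  obtain ⟨l, x, h0, hl, hx, hinj⟩ := exists_injOn_of_reflTransGen h
  exact ⟨⟨l, x⟩, h0, hl, hx, hinj⟩

open Classical in
/-- The edges on the paths from `u` to `v`. -/
noncomputable def between (D : Finset (V × V)) (u v : V) : Finset (V × V) :=
  D.filter fun b => Reach D u b.1 ∧ Reach D b.2 v

theorem mem_between {D : Finset (V × V)} {u v : V} {b : V × V} :
    b ∈ between D u v ↔ b ∈ D ∧ Reach D u b.1 ∧ Reach D b.2 v := by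
  classical
  simp [between]

/-- Every edge of a path from `u` to `v` lies in `between D u v`, so this set can replace a chosen
detour. Its two defining conditions are what the invariants of `TwoWalks` ask about detour edges. -/
theorem Reach.between {D : Finset (V × V)} {u v : V} (h : Reach D u v) :
    Reach (between D u v) u v := by
  have : ∀ w, Reach D w v → Reach D u w → Reach (FTRS.between D u v) w v := by
    intro w hw
    induction hw using ReflTransGen.head_induction_on with
    | refl => exact fun _ => Reach.refl _ _
    | @head b c hbc hct ih =>
      intro hub
      exact Reach.trans (Reach.single (e := (b, c)) (mem_between.2 ⟨hbc, hub, hct⟩))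
        (ih (hub.trans (Reach.single (e := (b, c)) hbc)))
  exact this u h (Reach.refl _ _)

variable [DecidableEq V]

/-- Cut the path just before its first use of `e`. -/
theorem Reach.erase_or_left {E : Finset (V × V)} {s t : V} (h : Reach E s t) (e : V × V) :
    Reach (E.erase e) s t ∨ Reach (E.erase e) s e.1 := by
  induction h with
  | refl => exact Or.inl (Reach.refl _ _)
  | @tail b c _ hbc ih =>
    rcases ih with ih | ih
    · by_cases he : (b, c) = e
      · subst he; exact Or.inr ih
      · exact Or.inl (ih.trans (Reach.single (e := (b, c)) (Finset.mem_erase.2 ⟨he, hbc⟩)))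
    · exact Or.inr ih

theorem Reach.erase_or_right {E : Finset (V × V)} {s t : V} (h : Reach E s t) (e : V × V) :
    Reach (E.erase e) s t ∨ Reach (E.erase e) e.2 t := by
  induction h using ReflTransGen.head_induction_on with
  | refl => exact Or.inl (Reach.refl _ _)
  | @head b c hbc _ ih =>
    rcases ih with ih | ih
    · by_cases he : (b, c) = e
      · subst he; exact Or.inr ih
      · exact Or.inl ((Reach.single (e := (b, c)) (Finset.mem_erase.2 ⟨he, hbc⟩)).trans ih)
    · exact Or.inr ih

/-- Edges whose tails are on no path from `s` to `t` can be deleted. -/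
theorem Reach.sdiff {E M : Finset (V × V)} {s t : V} (h : Reach E s t)
    (hM : ∀ e ∈ M, Reach E s e.1 → ¬ Reach E e.1 t) : Reach (E \ M) s t := by
  have : ∀ u, Reach E u t → Reach E s u → Reach (E \ M) u t := by
    intro u hu
    induction hu using ReflTransGen.head_induction_on with
    | refl => exact fun _ => Reach.refl _ _
    | @head b c hbc hct ih =>
      intro hsb
      have hb : Reach E b c := Reach.single (e := (b, c)) hbc
      refine Reach.trans (Reach.single (e := (b, c)) (Finset.mem_sdiff.2 ⟨hbc, fun hm => ?_⟩))
        (ih (hsb.trans hb))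
      exact hM _ hm hsb (hb.trans hct)
  exact this s h (Reach.refl _ _)

namespace Route

/-- The vertices of a route. -/
def verts (p : Route V) : Finset V := (Finset.range (p.len + 1)).image p.vtx

/-- The edges of a route. -/
def edges (p : Route V) : Finset (V × V) :=
  (Finset.range p.len).image fun i => (p.vtx i, p.vtx (i + 1))

theorem mem_edges {p : Route V} {e : V × V} :
    e ∈ p.edges ↔ ∃ i < p.len, (p.vtx i, p.vtx (i + 1)) = e := by
  simp [edges]

theorem IsPath.edges_subset {p : Route V} {E : Finset (V × V)} {s t : V} (h : p.IsPath E s t) :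
    p.edges ⊆ E := by
  intro e he
  obtain ⟨i, hi, rfl⟩ := mem_edges.1 he
  exact h.mem i hi

theorem IsPath.of_edges_subset {p : Route V} {E E' : Finset (V × V)} {s t : V}
    (h : p.IsPath E s t) (hE : p.edges ⊆ E') : p.IsPath E' s t :=
  ⟨h.source, h.target, fun i hi => hE (mem_edges.2 ⟨i, hi, rfl⟩), h.inj⟩

/-- A path reaches each of its vertices, and its end from each of them. -/
theorem IsPath.reach_of_mem_verts {p : Route V} {E : Finset (V × V)} {s t v : V}
    (h : p.IsPath E s t) (hv : v ∈ p.verts) : Reach E s v ∧ Reach E v t := by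
  obtain ⟨i, hi, rfl⟩ := Finset.mem_image.1 hv
  have hi' : i ≤ p.len := by simpa [Nat.lt_succ_iff] using hi
  rw [← h.source, ← h.target]
  exact ⟨reach_of_mem (Nat.zero_le _) fun k _ hk => h.mem k (by omega),
    reach_of_mem hi' fun k _ hk => h.mem k hk⟩

theorem card_verts {p : Route V} (h : Set.InjOn p.vtx (Set.Iic p.len)) :
    p.verts.card = p.len + 1 := by
  rw [verts, Finset.card_image_of_injOn, Finset.card_range]
  intro i hi j hj hij
  exact h (by simpa [Nat.lt_succ_iff] using hi) (by simpa [Nat.lt_succ_iff] using hj) hij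

theorem card_edges_le (p : Route V) : p.edges.card ≤ p.len :=
  Finset.card_image_le.trans (by simp)

end Route

/-- An edge of a path that no detour bypasses is a bridge. -/
theorem Route.IsPath.not_reach_erase {p : Route V} {E : Finset (V × V)} {s t : V}
    (h : p.IsPath E s t) {i : ℕ} (hi : i < p.len)
    (hd : ∀ k ≤ i, ∀ m ≤ p.len, Reach (E \ p.edges) (p.vtx k) (p.vtx m) → m ≤ i) :
    ¬ Reach (E.erase (p.vtx i, p.vtx (i + 1))) s t := by
  intro hr
  -- The only edge of `E` that can leave `X` is the edge of `p` with index `i`: an edge off `p`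
  -- prolongs a detour, and by `hd` an edge of `p` with tail in `X` has index at most `i`.
  let X : Set V := {v | ∃ k ≤ i, Reach (E \ p.edges) (p.vtx k) v}
  have hs : s ∈ X := ⟨0, Nat.zero_le _, h.source ▸ Reach.refl _ _⟩
  have ht : t ∉ X := by
    rintro ⟨k, hk, hkt⟩
    rw [← h.target] at hkt
    exact absurd (hd k hk _ le_rfl hkt) (by omega)
  obtain ⟨u, v, huv, ⟨k, hk, hku⟩, hv, -⟩ := exists_exit_of_reflTransGen hr hs ht
  rw [Finset.mem_erase] at huv
  by_cases hA : (u, v) ∈ p.edges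
  · obtain ⟨m, hm, hme⟩ := Route.mem_edges.1 hA
    obtain ⟨rfl, rfl⟩ := Prod.mk.inj hme
    have h1 : m ≤ i := hd k hk m hm.le hku
    have h2 : ¬ m + 1 ≤ i := fun hc => hv ⟨m + 1, hc, Reach.refl _ _⟩
    have : m = i := by omega
    subst this
    exact huv.1 rfl
  · exact hv ⟨k, hk, hku.trans
      (Reach.single (e := (u, v)) (Finset.mem_sdiff.2 ⟨huv.2, hA⟩))⟩

/-- Two edge sets that lead from `s` to the vertices `i` and `j` of the path `p`, have only bridges
in common, and leave the edges of `p` from `i` on unused; `j` is the farthest vertex of `p` that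
can be reached by detours from the vertices before `i` or from the detours in use. -/
structure TwoWalks (E : Finset (V × V)) (s t : V) (p : Route V) (i j : ℕ)
    (U W : Finset (V × V)) : Prop where
  subU : U ⊆ E
  subW : W ⊆ E
  reachU : Reach U s (p.vtx i)
  reachW : Reach W s (p.vtx j)
  shared : ∀ b ∈ U, b ∈ W → ¬ Reach (E.erase b) s t
  freeU : ∀ k, i ≤ k → k < p.len → (p.vtx k, p.vtx (k + 1)) ∉ U
  freeW : ∀ k, i ≤ k → k < p.len → (p.vtx k, p.vtx (k + 1)) ∉ W
  detour : ∀ k < i, ∀ m ≤ p.len, Reach (E \ p.edges) (p.vtx k) (p.vtx m) → m ≤ j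
  tailsU : ∀ b ∈ U, b ∉ p.edges → ∀ m ≤ p.len, Reach (E \ p.edges) b.1 (p.vtx m) → m ≤ j
  tailsW : ∀ b ∈ W, b ∉ p.edges → ∀ m ≤ p.len, Reach (E \ p.edges) b.1 (p.vtx m) → m ≤ j

/-- The edges of a route with indices from `i` up to, but not including, `j`. -/
def Route.segment (p : Route V) (i j : ℕ) : Finset (V × V) :=
  (Finset.Ico i j).image fun k => (p.vtx k, p.vtx (k + 1))

theorem Route.mem_segment {p : Route V} {i j : ℕ} {e : V × V} :
    e ∈ p.segment i j ↔ ∃ k, i ≤ k ∧ k < j ∧ (p.vtx k, p.vtx (k + 1)) = e := by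
  simp [segment, and_assoc]

theorem Route.reach_segment (p : Route V) {i j : ℕ} (hij : i ≤ j) :
    Reach (p.segment i j) (p.vtx i) (p.vtx j) :=
  reach_of_mem hij fun k h1 h2 => mem_segment.2 ⟨k, h1, h2, rfl⟩

theorem Route.segment_subset_edges {p : Route V} {i j : ℕ} (hj : j ≤ p.len) :
    p.segment i j ⊆ p.edges := by
  intro e he
  obtain ⟨k, _, h2, h3⟩ := mem_segment.1 he
  exact mem_edges.2 ⟨k, by omega, h3⟩

theorem Route.IsPath.notMem_segment {p : Route V} {E : Finset (V × V)} {s t : V}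
    (h : p.IsPath E s t) {i j k : ℕ} (hj : j ≤ p.len) (hk : k < p.len) (hkj : j ≤ k ∨ k < i) :
    (p.vtx k, p.vtx (k + 1)) ∉ p.segment i j := by
  intro hm
  obtain ⟨m, h1, h2, h3⟩ := mem_segment.1 hm
  have := h.index_unique (by omega) hk.le (Prod.mk.inj h3).1
  omega

/-- One step in the construction of two paths with only bridges in common. -/
theorem TwoWalks.step {E : Finset (V × V)} {s t : V} {p : Route V} (hp : p.IsPath E s t)
    {i j : ℕ} {U W : Finset (V × V)} (h : TwoWalks E s t p i j U W) (hij : i ≤ j)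
    (hj : j ≤ p.len) (hi : i < p.len) :
    ∃ i' j' U' W', TwoWalks E s t p i' j' U' W' ∧ i' ≤ j' ∧ j' ≤ p.len ∧ i + j < i' + j' := by
  classical
  -- the number of path vertices from which detours are tried
  let N := max j (i + 1)
  have hN : i < N ∧ j ≤ N ∧ N ≤ p.len ∧ (N = j ∨ i = j ∧ N = i + 1) := by
    simp only [N]; omega
  let S := (Finset.range (p.len + 1)).filter
    fun m => ∃ k < N, Reach (E \ p.edges) (p.vtx k) (p.vtx m)
  have hS : ∀ m, m ∈ S ↔ m ≤ p.len ∧ ∃ k < N, Reach (E \ p.edges) (p.vtx k) (p.vtx m) := by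
    intro m; simp [S]
  have hSne : S.Nonempty := ⟨i, (hS i).2 ⟨hi.le, i, hN.1, Reach.refl _ _⟩⟩
  obtain ⟨hml, k, hkN, hkm⟩ := (hS _).1 (S.max'_mem hSne)
  have hmax : ∀ k < N, ∀ m' ≤ p.len, Reach (E \ p.edges) (p.vtx k) (p.vtx m') →
      m' ≤ S.max' hSne := fun k hk m' hm' hr => S.le_max' _ ((hS m').2 ⟨hm', k, hk, hr⟩)
  set m := S.max' hSne with hm_def
  by_cases hmj : m ≤ j
  · by_cases hlt : i < j
    -- No detour from before `j` passes `j`, so the walk that lags behind may follow `p` up to `j`.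
    · have hNj : N = j := by omega
      refine ⟨j, j, U ∪ p.segment i j, W, ?_, le_rfl, hj, by omega⟩
      refine ⟨Finset.union_subset h.subU ((Route.segment_subset_edges hj).trans hp.edges_subset),
        h.subW, (h.reachU.mono Finset.subset_union_left).trans
          ((p.reach_segment hij).mono Finset.subset_union_right), h.reachW, ?_, ?_,
        fun k hk => h.freeW k (by omega), fun k hk m' hm' hr => (hmax k (by omega) m' hm' hr).trans hmj,
        ?_, h.tailsW⟩
      · intro b hb hbW
        rcases Finset.mem_union.1 hb with hb | hb
        · exact h.shared b hb hbW
        · obtain ⟨k, h1, h2, rfl⟩ := Route.mem_segment.1 hb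
          exact absurd hbW (h.freeW k h1 (by omega))
      · intro k hk hkl hb
        rcases Finset.mem_union.1 hb with hb | hb
        · exact h.freeU k (by omega) hkl hb
        · exact hp.notMem_segment hj hkl (Or.inl hk) hb
      · intro b hb hbA
        rcases Finset.mem_union.1 hb with hb | hb
        · exact h.tailsU b hb hbA
        · exact absurd (Route.segment_subset_edges hj hb) hbA
    -- Both walks are at `i`, and no detour starting at or before `i` passes `i`. The next edge of
    -- `p` is then a bridge, and both walks may use it.
    · have hij' : i = j := by omega
      subst hij'
      have hNi : N = i + 1 := by omega
      have hbr : ¬ Reach (E.erase (p.vtx i, p.vtx (i + 1))) s t :=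
        hp.not_reach_erase hi fun k hk m' hm' hr => (hmax k (by omega) m' hm' hr).trans hmj
      have hmem := hp.mem i hi
      have hstep : ∀ U : Finset (V × V), Reach U s (p.vtx i) →
          Reach (insert (p.vtx i, p.vtx (i + 1)) U) s (p.vtx (i + 1)) := fun U hU =>
        (hU.mono (Finset.subset_insert _ _)).trans
          (Reach.single (e := (p.vtx i, p.vtx (i + 1))) (Finset.mem_insert_self _ _))
      have hfree : ∀ U : Finset (V × V), (∀ k, i ≤ k → k < p.len →
          (p.vtx k, p.vtx (k + 1)) ∉ U) → ∀ k, i + 1 ≤ k → k < p.len →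
          (p.vtx k, p.vtx (k + 1)) ∉ insert (p.vtx i, p.vtx (i + 1)) U := by
        intro U hU k hk hkl hc
        rcases Finset.mem_insert.1 hc with hc | hc
        · have := hp.index_unique hkl.le hi.le (Prod.mk.inj hc).1
          omega
        · exact hU k (by omega) hkl hc
      have htails : ∀ U : Finset (V × V), (∀ b ∈ U, b ∉ p.edges → ∀ m ≤ p.len,
          Reach (E \ p.edges) b.1 (p.vtx m) → m ≤ i) →
          ∀ b ∈ insert (p.vtx i, p.vtx (i + 1)) U, b ∉ p.edges → ∀ m ≤ p.len,
          Reach (E \ p.edges) b.1 (p.vtx m) → m ≤ i + 1 := by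
        intro U hU b hb hbA m' hm' hr
        rcases Finset.mem_insert.1 hb with rfl | hb
        · exact absurd (Route.mem_edges.2 ⟨i, hi, rfl⟩) hbA
        · exact (hU b hb hbA m' hm' hr).trans (by omega)
      refine ⟨i + 1, i + 1, insert (p.vtx i, p.vtx (i + 1)) U, insert (p.vtx i, p.vtx (i + 1)) W,
        ⟨Finset.insert_subset hmem h.subU, Finset.insert_subset hmem h.subW, hstep U h.reachU,
          hstep W h.reachW, ?_, hfree U h.freeU, hfree W h.freeW,
          fun k hk m' hm' hr => (hmax k (by omega) m' hm' hr).trans (by omega),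
          htails U h.tailsU, htails W h.tailsW⟩, le_rfl, by omega, by omega⟩
      intro b hb hb'
      rcases Finset.mem_insert.1 hb with rfl | hb
      · exact hbr
      · rcases Finset.mem_insert.1 hb' with rfl | hb'
        · exact hbr
        · exact h.shared b hb hb'
  -- A detour from `k` ends at `m > j`. The lagging walk follows `p` from `i` to `k`, takes the
  -- detour and becomes the leading one, so the roles of `U` and `W` are exchanged. The detour
  -- shares no edge with `W`: by `tailsW` no detour from the tail of an edge of `W` off `p` gets
  -- beyond `j`.
  · have hik : i ≤ k := by
      by_contra hc
      exact hmj (h.detour k (by omega) m hml hkm)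
    have hkj : k ≤ j := by omega
    have hbet : FTRS.between (E \ p.edges) (p.vtx k) (p.vtx m) ⊆ E \ p.edges :=
      fun b hb => (mem_between.1 hb).1
    refine ⟨j, m, W, U ∪ p.segment i k ∪ FTRS.between (E \ p.edges) (p.vtx k) (p.vtx m), ?_,
      by omega, hml, by omega⟩
    refine ⟨h.subW, ?_, h.reachW, ?_, ?_, fun k hk => h.freeW k (by omega), ?_, ?_,
      fun b hb hbA m' hm' hr => (h.tailsW b hb hbA m' hm' hr).trans (by omega), ?_⟩
    · exact Finset.union_subset (Finset.union_subset h.subU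
        ((Route.segment_subset_edges (by omega)).trans hp.edges_subset))
        (hbet.trans Finset.sdiff_subset)
    · refine ((h.reachU.mono ?_).trans ((p.reach_segment hik).mono ?_)).trans
        (hkm.between.mono Finset.subset_union_right)
      · exact Finset.subset_union_left.trans Finset.subset_union_left
      · exact Finset.subset_union_right.trans Finset.subset_union_left
    · intro b hbW hb
      rcases Finset.mem_union.1 hb with hb | hb
      · rcases Finset.mem_union.1 hb with hb | hb
        · exact h.shared b hb hbW
        · obtain ⟨k', h1, h2, rfl⟩ := Route.mem_segment.1 hb
          exact absurd hbW (h.freeW k' h1 (by omega))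
      · obtain ⟨hbD, -, hb2⟩ := mem_between.1 hb
        exact absurd (h.tailsW b hbW (Finset.mem_sdiff.1 hbD).2 m hml
          ((Reach.single hbD).trans hb2)) hmj
    · intro k' hk' hkl hb
      rcases Finset.mem_union.1 hb with hb | hb
      · rcases Finset.mem_union.1 hb with hb | hb
        · exact h.freeU k' (by omega) hkl hb
        · exact hp.notMem_segment (by omega) hkl (Or.inl (by omega)) hb
      · exact (Finset.mem_sdiff.1 (hbet hb)).2 (Route.mem_edges.2 ⟨k', hkl, rfl⟩)
    · exact fun k' hk' m' hm' hr => hmax k' (by omega) m' hm' hr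
    · intro b hb hbA m' hm' hr
      rcases Finset.mem_union.1 hb with hb | hb
      · rcases Finset.mem_union.1 hb with hb | hb
        · exact (h.tailsU b hb hbA m' hm' hr).trans (by omega)
        · exact absurd (Route.segment_subset_edges (by omega) hb) hbA
      · exact hmax k hkN m' hm' ((mem_between.1 hb).2.1.trans hr)

/-- If `t` is reachable from `s`, then there are two paths from `s` to `t` that have only bridges
in common. -/
theorem Reach.exists_two_routes {E : Finset (V × V)} {s t : V} (h : Reach E s t) :
    ∃ p q : Route V, p.IsPath E s t ∧ q.IsPath E s t ∧
      ∀ b ∈ p.edges, b ∈ q.edges → ¬ Reach (E.erase b) s t := by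
  obtain ⟨p, hp⟩ := h.exists_route
  have key : ∀ N, ∃ i j U W, TwoWalks E s t p i j U W ∧ i ≤ j ∧ j ≤ p.len ∧
      (i = p.len ∨ N ≤ i + j) := by
    intro N
    induction N with
    | zero =>
      refine ⟨0, 0, ∅, ∅, ⟨by simp, by simp, ?_, ?_, by simp, by simp, by simp, by simp, by simp,
        by simp⟩, le_rfl, by simp, Or.inr (by simp)⟩ <;> exact hp.source ▸ Reach.refl _ _
    | succ N ih =>
      obtain ⟨i, j, U, W, h1, h2, h3, h4⟩ := ih
      by_cases hi : i = p.len
      · exact ⟨i, j, U, W, h1, h2, h3, Or.inl hi⟩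
      · obtain ⟨i', j', U', W', h1', h2', h3', h4'⟩ := h1.step hp h2 h3 (by omega)
        exact ⟨i', j', U', W', h1', h2', h3', Or.inr (by omega)⟩
  -- As `i + j` cannot exceed `2 * p.len`, both walks have arrived.
  obtain ⟨i, j, U, W, h1, h2, h3, h4⟩ := key (2 * p.len + 1)
  have hi : i = p.len := by omega
  have hj : j = p.len := by omega
  subst hi
  have hU := h1.reachU
  have hW := h1.reachW
  rw [hj, hp.target] at hW
  rw [hp.target] at hU
  obtain ⟨q, hq⟩ := hU.exists_route
  obtain ⟨q', hq'⟩ := hW.exists_route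
  exact ⟨q, q', hq.of_edges_subset (hq.edges_subset.trans h1.subU),
    hq'.of_edges_subset (hq'.edges_subset.trans h1.subW),
    fun b hb hb' => h1.shared b (hq.edges_subset hb) (hq'.edges_subset hb')⟩

end Routes

end FTRS

/-! ### Cuts, and the number of edges critical for one source or target. -/

namespace FTRS

section Degree

open Relation

variable {V : Type*} [DecidableEq V]

/-- The edges of `E` that leave the vertex set `X`. -/
def cut (E : Finset (V × V)) (X : Finset V) : Finset (V × V) :=
  E.filter fun e => e.1 ∈ X ∧ e.2 ∉ X

theorem mem_cut {E : Finset (V × V)} {X : Finset V} {e : V × V} :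
    e ∈ cut E X ↔ e ∈ E ∧ e.1 ∈ X ∧ e.2 ∉ X := by simp [cut]

/-- The cut function is submodular. -/
theorem card_cut_union_add_card_cut_inter_le (E : Finset (V × V)) (X Y : Finset V) :
    (cut E (X ∪ Y)).card + (cut E (X ∩ Y)).card ≤ (cut E X).card + (cut E Y).card := by
  rw [← Finset.card_union_add_card_inter, ← Finset.card_union_add_card_inter (cut E X)]
  refine Nat.add_le_add (Finset.card_le_card fun e => ?_) (Finset.card_le_card fun e => ?_)
  · simp only [Finset.mem_union, Finset.mem_inter, mem_cut]
    tauto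
  · simp only [Finset.mem_union, Finset.mem_inter, mem_cut]
    tauto

/-- The tails `I` of edges into `v` are separated from `v` by cuts with at most three edges, each
of which contains the edge of its tail, and each tail can be reached from `A` on the near side of
its cut; every cut that separates `A` from `v` has at least `c` edges. -/
structure SeparatedTails (E : Finset (V × V)) (v : V) (c : ℕ) (A I : Finset V) : Prop where
  notMem : v ∉ A
  le_cut : ∀ X, A ⊆ X → v ∉ X → c ≤ (cut E X).card
  tails : ∀ u ∈ I, (u, v) ∈ E ∧ ∃ X, A ⊆ X ∧ v ∉ X ∧ u ∈ X ∧ (cut E X).card ≤ 3 ∧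
    ∃ a ∈ A, Reach (E.filter fun e => e.2 ∈ X) a u

/-- Let `M` be a largest cut of size `c`. Tails inside `M` account for at most `c` edges of the cut,
as their edges to `v` leave `M`. A tail outside is reached through the head of some cut edge `b`.
Since `M` is largest, adding `b.2` to it raises the minimum cut to at least `c + 1`, so `B` bounds
the tails assigned to each of the `c` choices of `b`. If no cut has size `c`, the bound `B` applies
at once. -/
theorem SeparatedTails.card_le_step [Fintype V] {E : Finset (V × V)} {v : V} {c B B' : ℕ}
    (hB : ∀ A I, SeparatedTails E v (c + 1) A I → I.card ≤ B) (hBB : B ≤ B') (hc : c + c * B ≤ B')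
    {A I : Finset V} (h : SeparatedTails E v c A I) : I.card ≤ B' := by
  classical
  -- the minimum cuts
  let S : Finset (Finset V) :=
    Finset.univ.filter fun X => A ⊆ X ∧ v ∉ X ∧ (cut E X).card = c
  by_cases hS : S.Nonempty
  · obtain ⟨M, hMS, hMmax⟩ := S.exists_max_image Finset.card hS
    obtain ⟨hAM, hvM, hMc⟩ : A ⊆ M ∧ v ∉ M ∧ (cut E M).card = c := by simpa [S] using hMS
    have hbig : ∀ X, M ⊆ X → v ∉ X → X ≠ M → c + 1 ≤ (cut E X).card := by
      intro X hMX hvX hne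
      rcases (h.le_cut X (hAM.trans hMX) hvX).eq_or_lt with h1 | h1
      · have : X ∈ S := by simpa [S] using ⟨hAM.trans hMX, hvX, h1.symm⟩
        exact absurd (Finset.eq_of_subset_of_card_le hMX (hMmax X this)).symm hne
      · exact h1
    let J : V × V → Finset V := fun b => (I \ M).filter fun u =>
      ∃ X, M ⊆ X ∧ v ∉ X ∧ u ∈ X ∧ (cut E X).card ≤ 3 ∧ b.2 ∈ X ∧
        Reach (E.filter fun e => e.2 ∈ X) b.2 u
    have hcover : I ⊆ (cut E M).image Prod.fst ∪ (cut E M).biUnion J := by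
      intro u hu
      obtain ⟨huv, X, hAX, hvX, huX, hX3, a, haA, hau⟩ := h.tails u hu
      by_cases huM : u ∈ M
      · exact Finset.mem_union_left _
          (Finset.mem_image.2 ⟨(u, v), mem_cut.2 ⟨huv, huM, hvM⟩, rfl⟩)
      · obtain ⟨y, w, hyw, hyM, hwM, hwu⟩ :=
          exists_exit_of_reflTransGen hau (X := (M : Set V)) (hAM haA) huM
        rw [Finset.mem_filter] at hyw
        refine Finset.mem_union_right _ (Finset.mem_biUnion.2 ⟨(y, w),
          mem_cut.2 ⟨hyw.1, hyM, hwM⟩, Finset.mem_filter.2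
          ⟨Finset.mem_sdiff.2 ⟨hu, huM⟩, X ∪ M, Finset.subset_union_right, ?_,
          Finset.mem_union_left _ huX, ?_, Finset.mem_union_left _ hyw.2, ?_⟩⟩)
        · simp [hvX, hvM]
        -- Submodularity: `X ∩ M` still separates `A` from `v`, so its cut is at least that of `M`,
        -- and hence the cut of `X ∪ M` is at most that of `X`.
        · have h1 := card_cut_union_add_card_cut_inter_le E X M
          have h2 := h.le_cut (X ∩ M) (Finset.subset_inter hAX hAM) (by simp [hvX])
          omega
        · refine Reach.mono hwu fun e he => ?_
          rw [Finset.mem_filter] at he ⊢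
          exact ⟨he.1, Finset.mem_union_left _ he.2⟩
    have hJ : ∀ b ∈ cut E M, (J b).card ≤ B := by
      intro b hb
      obtain ⟨hbE, hb1, hb2⟩ := mem_cut.1 hb
      rcases (J b).eq_empty_or_nonempty with he | ⟨u₀, hu₀⟩
      · simp [he]
      · have hbv : b.2 ≠ v := by
          rintro rfl
          obtain ⟨-, X, -, hvX, -, -, hbX, -⟩ := Finset.mem_filter.1 hu₀
          exact hvX hbX
        refine hB (insert b.2 M) (J b) ⟨?_, ?_, ?_⟩
        · simp [hvM, hbv.symm]
        · intro X hX hvX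
          refine hbig X ((Finset.subset_insert _ _).trans hX) hvX ?_
          rintro rfl
          exact hb2 (hX (Finset.mem_insert_self _ _))
        · intro u hu
          obtain ⟨huI, X, hMX, hvX, huX, hX3, hbX, hr⟩ := Finset.mem_filter.1 hu
          exact ⟨(h.tails u (Finset.mem_sdiff.1 huI).1).1, X, Finset.insert_subset hbX hMX, hvX,
            huX, hX3, b.2, Finset.mem_insert_self _ _, hr⟩
    calc I.card ≤ _ := Finset.card_le_card hcover
      _ ≤ _ := Finset.card_union_le _ _
      _ ≤ c + c * B := by
        refine Nat.add_le_add (Finset.card_image_le.trans hMc.le) ?_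
        rw [← hMc]
        exact Finset.card_biUnion_le_card_mul _ _ _ hJ
      _ ≤ B' := hc
  · refine (hB A I ⟨h.notMem, fun X hAX hvX => ?_, h.tails⟩).trans hBB
    rcases (h.le_cut X hAX hvX).eq_or_lt with h1 | h1
    · exact absurd ⟨X, by simpa [S] using ⟨hAX, hvX, h1.symm⟩⟩ hS
    · exact h1

/-- With minimum cut at least `4` there are no tails, as each tail has a cut with at most three
edges. Going down, the bound `c + c * B` gives `3`, `2 + 2 * 3 = 8` and `1 + 1 * 8 = 9`; for `c = 0`
the earlier bound `9` is kept. -/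
theorem SeparatedTails.card_le [Fintype V] {E : Finset (V × V)} {v : V} {A I : Finset V}
    (h : SeparatedTails E v 0 A I) : I.card ≤ 9 := by
  have h4 : ∀ A I, SeparatedTails E v 4 A I → I.card ≤ 0 := by
    intro A I h
    rw [Nat.le_zero, Finset.card_eq_zero, Finset.eq_empty_iff_forall_notMem]
    intro u hu
    obtain ⟨-, X, hAX, hvX, -, hX3, -⟩ := h.tails u hu
    have := h.le_cut X hAX hvX
    omega
  have h3 : ∀ A I, SeparatedTails E v 3 A I → I.card ≤ 3 := fun A I h =>
    h.card_le_step h4 (by norm_num) (by norm_num)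
  have h2 : ∀ A I, SeparatedTails E v 2 A I → I.card ≤ 8 := fun A I h =>
    h.card_le_step h3 (by norm_num) (by norm_num)
  have h1 : ∀ A I, SeparatedTails E v 1 A I → I.card ≤ 9 := fun A I h =>
    h.card_le_step h2 (by norm_num) (by norm_num)
  exact h.card_le_step h1 le_rfl (by norm_num)

/-- After the deletion of `F`, all paths in `E` from `s` to `t` use the edge `e`, and there is such
a path. -/
def Critical (E : Finset (V × V)) (e : V × V) (s t : V) (F : Finset (V × V)) : Prop :=
  Reach (E \ F) s t ∧ ¬ Reach ((E \ F).erase e) s t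

theorem Critical.mem {E : Finset (V × V)} {e : V × V} {s t : V} {F : Finset (V × V)}
    (h : Critical E e s t F) : e ∈ E \ F := by
  by_contra hc
  exact h.2 (by rw [Finset.erase_eq_of_notMem hc]; exact h.1)

/-- A way to `e.2` that avoids `e` could be continued to `t` without `e`. The target may thus be
replaced by the head of the edge, and critical edges can be counted head by head. -/
theorem Critical.head {E : Finset (V × V)} {e : V × V} {s t : V} {F : Finset (V × V)}
    (h : Critical E e s t F) : Critical E e s e.2 F := by
  refine ⟨?_, fun hc => ?_⟩
  · exact (((h.1.erase_or_left e).resolve_left h.2).mono (Finset.erase_subset _ _)).trans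
      (Reach.single h.mem)
  · exact h.2 (hc.trans ((h.1.erase_or_right e).resolve_left h.2))

/-- An edge critical for `s` and `t` is critical for one half of any way from `s` to `t`. -/
theorem Critical.split {E : Finset (V × V)} {e : V × V} {s t r : V} {F : Finset (V × V)}
    (h : Critical E e s t F) (h1 : Reach (E \ F) s r) (h2 : Reach (E \ F) r t) :
    Critical E e s r F ∨ Critical E e r t F := by
  by_contra! hc
  exact h.2 ((not_not.1 fun h' => hc.1 ⟨h1, h'⟩).trans (not_not.1 fun h' => hc.2 ⟨h2, h'⟩))

/-- Take as the cut for `u` the set of vertices that `s` reaches after the deletion of `F` and `(u,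
v)`. Only these at most three edges can leave it, and a path from `s` to `u` inside it exists
because `(u, v)` is critical. -/
theorem card_le_nine_of_critical [Fintype V] {E : Finset (V × V)} {s v : V} {I : Finset V}
    (hI : ∀ u ∈ I, ∃ F : Finset (V × V), F.card ≤ 2 ∧ Critical E (u, v) s v F) :
    I.card ≤ 9 := by
  classical
  rcases I.eq_empty_or_nonempty with rfl | ⟨u₀, hu₀⟩
  · simp
  refine SeparatedTails.card_le (E := E) (v := v) (A := {s}) ⟨?_, fun _ _ _ => Nat.zero_le _, ?_⟩
  · obtain ⟨F, -, -, h⟩ := hI u₀ hu₀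
    rw [Finset.mem_singleton]
    rintro rfl
    exact h (Reach.refl _ _)
  · intro u hu
    obtain ⟨F, hF, hcr⟩ := hI u hu
    have hm := Finset.mem_sdiff.1 hcr.mem
    refine ⟨hm.1, Finset.univ.filter fun y => Reach ((E \ F).erase (u, v)) s y, ?_, ?_, ?_, ?_,
      s, Finset.mem_singleton_self _, ?_⟩
    · simpa using Reach.refl _ _
    · simpa using hcr.2
    · simpa using (hcr.1.erase_or_left (u, v)).resolve_left hcr.2
    · refine (Finset.card_le_card (t := insert (u, v) F) fun e he => ?_).trans
        ((Finset.card_insert_le _ _).trans (by omega))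
      simp only [mem_cut, Finset.mem_filter, Finset.mem_univ, true_and] at he
      by_contra hc
      rw [Finset.mem_insert, not_or] at hc
      exact he.2.2 (he.2.1.trans (Reach.single
        (Finset.mem_erase.2 ⟨hc.1, Finset.mem_sdiff.2 ⟨he.1, hc.2⟩⟩)))
    · have key : ∀ y, Reach ((E \ F).erase (u, v)) s y →
          Reach (E.filter fun e => Reach ((E \ F).erase (u, v)) s e.2) s y := by
        intro y hy
        induction hy with
        | refl => exact Reach.refl _ _
        | @tail b c hb hbc ih =>
          refine Reach.trans ih (Reach.single (e := (b, c)) ?_)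
          simp only [Finset.mem_filter]
          exact ⟨(Finset.mem_sdiff.1 (Finset.mem_of_mem_erase hbc)).1,
            Reach.trans hb (Reach.single (e := (b, c)) hbc)⟩
      simpa using key u ((hcr.1.erase_or_left (u, v)).resolve_left hcr.2)

/-- At most `9 n` edges are critical for a fixed source. -/
theorem card_critical_source_le [Fintype V] {E D : Finset (V × V)} {s : V}
    (hD : ∀ e ∈ D, ∃ (t : V) (F : Finset (V × V)), F.card ≤ 2 ∧ Critical E e s t F) :
    D.card ≤ 9 * Fintype.card V := by
  classical
  have : ∀ v ∈ (Finset.univ : Finset V), (D.filter fun e => e.2 = v).card ≤ 9 := by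
    intro v _
    rw [← Finset.card_image_of_injOn (f := Prod.fst)]
    · refine card_le_nine_of_critical (E := E) (s := s) (v := v) fun u hu => ?_
      obtain ⟨⟨u', v'⟩, he, rfl⟩ := Finset.mem_image.1 hu
      obtain ⟨heD, rfl⟩ := Finset.mem_filter.1 he
      obtain ⟨t, F, hF, hcr⟩ := hD _ heD
      exact ⟨F, hF, hcr.head⟩
    · rintro ⟨a, b⟩ h1 ⟨c, d⟩ h2 h3
      simp only [Finset.coe_filter, Set.mem_ofPred_eq] at h1 h2 h3
      exact Prod.ext h3 (h1.2.trans h2.2.symm)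
  calc D.card = _ := Finset.card_eq_sum_card_fiberwise (f := Prod.snd) (t := Finset.univ) (by simp)
    _ ≤ _ := Finset.sum_le_card_nsmul _ _ 9 this
    _ = 9 * Fintype.card V := by simp [mul_comm]

theorem mem_image_swap {E : Finset (V × V)} {e : V × V} :
    e ∈ E.image Prod.swap ↔ e.swap ∈ E := by
  simp [Prod.swap_eq_iff_eq_swap]

theorem reach_image_swap {E : Finset (V × V)} {s t : V} :
    Reach (E.image Prod.swap) s t ↔ Reach E t s := by
  have : ∀ {E : Finset (V × V)} {s t : V}, Reach E t s → Reach (E.image Prod.swap) s t := by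
    intro E s t h
    induction h with
    | refl => exact Reach.refl _ _
    | @tail b c _ hbc ih =>
      exact (Reach.single (e := (c, b)) (mem_image_swap.2 hbc)).trans ih
  refine ⟨fun h => ?_, this⟩
  have h' := this h
  rwa [Finset.image_image, Prod.swap_swap_eq, Finset.image_id] at h'

theorem Critical.swap {E : Finset (V × V)} {e : V × V} {s t : V} {F : Finset (V × V)}
    (h : Critical E e s t F) :
    Critical (E.image Prod.swap) e.swap t s (F.image Prod.swap) := by
  have hinj : Function.Injective (Prod.swap : V × V → V × V) := Prod.swap_injective
  refine ⟨?_, ?_⟩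
  · rw [← Finset.image_sdiff _ _ hinj, reach_image_swap]
    exact h.1
  · rw [← Finset.image_sdiff _ _ hinj, ← Finset.image_erase hinj, reach_image_swap]
    exact h.2

/-- At most `9 n` edges are critical for a fixed target. -/
theorem card_critical_target_le [Fintype V] {E D : Finset (V × V)} {t : V}
    (hD : ∀ e ∈ D, ∃ (s : V) (F : Finset (V × V)), F.card ≤ 2 ∧ Critical E e s t F) :
    D.card ≤ 9 * Fintype.card V := by
  rw [← Finset.card_image_of_injective D Prod.swap_injective]
  refine card_critical_source_le (E := E.image Prod.swap) (s := t) fun e he => ?_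
  obtain ⟨s, F, hF, hcr⟩ := hD _ (mem_image_swap.1 he)
  exact ⟨s, F.image Prod.swap, Finset.card_image_le.trans hF, by simpa using hcr.swap⟩

end Degree

end FTRS

/-! ### Hitting sets and the count of critical edges. -/

namespace FTRS

section Counting

open Relation

/-- The sum telescopes against `(j + 1) ^ (r + 1) - j ^ (r + 1) ≥ (r + 1) * j ^ r`. -/
theorem mul_sum_range_pow_le (r n : ℕ) : (r + 1) * ∑ j ∈ Finset.range n, j ^ r ≤ n ^ (r + 1) := by
  have key : ∀ r n : ℕ, n ^ (r + 1) + (r + 1) * n ^ r ≤ (n + 1) ^ (r + 1) := by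
    intro r n
    induction r with
    | zero => simp
    | succ r ih =>
      calc n ^ (r + 1 + 1) + (r + 1 + 1) * n ^ (r + 1)
          ≤ (n ^ (r + 1) + (r + 1) * n ^ r) * (n + 1) := by
            rw [pow_succ n (r + 1), pow_succ n r]
            nlinarith [Nat.zero_le ((r + 1) * n ^ r)]
        _ ≤ (n + 1) ^ (r + 1) * (n + 1) := Nat.mul_le_mul_right _ ih
        _ = _ := (pow_succ _ _).symm
  induction n with
  | zero => simp
  | succ n ih =>
    rw [Finset.sum_range_succ, mul_add]
    exact (Nat.add_le_add_right ih _).trans (key r n)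

variable {V : Type*} [DecidableEq V]

/-- Of two paths that have only bridges in common, one survives any fault that does not disconnect
their ends. -/
theorem Route.IsPath.survives {E F : Finset (V × V)} {s t : V} {p q : Route V}
    (hp : p.IsPath E s t) (hq : q.IsPath E s t)
    (hpq : ∀ b ∈ p.edges, b ∈ q.edges → ¬ Reach (E.erase b) s t)
    (hF : F.card ≤ 1) (h : Reach (E \ F) s t) : p.IsPath (E \ F) s t ∨ q.IsPath (E \ F) s t := by
  by_contra! hc
  have aux : ∀ p : Route V, p.IsPath E s t → ¬ p.IsPath (E \ F) s t → ∃ b ∈ F, b ∈ p.edges := by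
    intro p hp hn
    by_contra! hc
    exact hn (hp.of_edges_subset fun b hb =>
      Finset.mem_sdiff.2 ⟨hp.edges_subset hb, fun hbF => hc b hbF hb⟩)
  obtain ⟨b, hbF, hbp⟩ := aux p hp hc.1
  obtain ⟨b', hbF', hbq⟩ := aux q hq hc.2
  obtain rfl := Finset.card_le_one.1 hF b hbF b' hbF'
  refine hpq b hbp hbq (h.mono fun e he => ?_)
  rw [Finset.mem_sdiff] at he
  exact Finset.mem_erase.2 ⟨fun h => he.2 (h ▸ hbF), he.1⟩

variable [Fintype V]

/-- For a family of sequences without repetitions there is a set of `r` vertices such that the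
parts of the sequences before this set are short on average. -/
theorem exists_short_prefixes {ι : Type*} (K : Finset ι) (l : ι → ℕ) (x : ι → ℕ → V)
    (hx : ∀ k ∈ K, Set.InjOn (x k) (Set.Iic (l k))) [Nonempty V] (r : ℕ) :
    ∃ R : Finset V, R.card ≤ r ∧
      (r + 1) * ∑ k ∈ K, ((Finset.range (l k + 1)).filter fun i => ∀ j ≤ i, x k j ∉ R).card ≤
        K.card * Fintype.card V := by
  set n := Fintype.card V with hn
  -- Average over all maps `f : Fin r → V`, that is, over `r` independent random vertices. As the
  -- entries of `x k` are distinct, exactly `(n - 1 - i) ^ r` maps miss the first `i + 1` of them.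
  have hone : ∀ k ∈ K, (r + 1) * ∑ f : Fin r → V, ((Finset.range (l k + 1)).filter
      fun i => ∀ j ≤ i, x k j ∉ Finset.univ.image f).card ≤ n ^ (r + 1) := by
    intro k hk
    have himg : ∀ i ≤ l k, ((Finset.range (i + 1)).image (x k)).card = i + 1 := by
      intro i hi
      rw [Finset.card_image_of_injOn, Finset.card_range]
      intro a ha b hb hab
      have ha' : a < i + 1 := by simpa using ha
      have hb' : b < i + 1 := by simpa using hb
      exact hx k hk (Set.mem_Iic.2 (by omega)) (Set.mem_Iic.2 (by omega)) hab
    have hln : l k + 1 ≤ n := by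
      rw [← himg _ le_rfl]
      exact Finset.card_le_univ _
    have hcount : ∀ i ∈ Finset.range (l k + 1), ((Finset.univ : Finset (Fin r → V)).filter
        fun f => ∀ j ≤ i, x k j ∉ Finset.univ.image f).card = (n - 1 - i) ^ r := by
      intro i hi
      have hi' : i < l k + 1 := Finset.mem_range.1 hi
      have : ((Finset.univ : Finset (Fin r → V)).filter
          fun f => ∀ j ≤ i, x k j ∉ Finset.univ.image f) =
          Fintype.piFinset fun _ : Fin r => ((Finset.range (i + 1)).image (x k))ᶜ := by
        ext f
        simp only [Finset.mem_filter, Finset.mem_univ, true_and, Fintype.mem_piFinset,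
          Finset.mem_compl, Finset.mem_image, Finset.mem_range, not_exists, not_and]
        constructor
        · intro h c j hj hjc
          exact h j (by omega) c hjc.symm
        · intro h j hj c hc
          exact h c j (by omega) hc.symm
      rw [this, Fintype.card_piFinset_const, Finset.card_compl, himg i (by omega)]
      congr 1
      omega
    calc (r + 1) * ∑ f : Fin r → V, ((Finset.range (l k + 1)).filter
          fun i => ∀ j ≤ i, x k j ∉ Finset.univ.image f).card
        = (r + 1) * ∑ i ∈ Finset.range (l k + 1), (n - 1 - i) ^ r := by
          congr 1
          simp only [Finset.card_filter]
          rw [Finset.sum_comm]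
          refine Finset.sum_congr rfl fun i hi => ?_
          rw [← hcount i hi, Finset.card_filter]
      _ ≤ (r + 1) * ∑ i ∈ Finset.range n, (n - 1 - i) ^ r := by
          refine Nat.mul_le_mul_left _ (Finset.sum_le_sum_of_subset ?_)
          exact Finset.range_subset_range.2 hln
      _ = (r + 1) * ∑ i ∈ Finset.range n, i ^ r := by
          rw [Finset.sum_range_reflect (fun i => i ^ r) n]
      _ ≤ n ^ (r + 1) := mul_sum_range_pow_le r n
  have hsum : ∑ f : Fin r → V, (r + 1) * ∑ k ∈ K, ((Finset.range (l k + 1)).filter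
      fun i => ∀ j ≤ i, x k j ∉ Finset.univ.image f).card ≤
      ∑ _f : Fin r → V, K.card * n := by
    rw [← Finset.mul_sum, Finset.sum_comm, Finset.mul_sum]
    refine (Finset.sum_le_card_nsmul _ _ _ hone).trans (le_of_eq ?_)
    simp only [smul_eq_mul, Finset.sum_const, Finset.card_univ, Fintype.card_pi_const, ← hn]
    ring
  obtain ⟨f, -, hf⟩ := Finset.exists_le_of_sum_le Finset.univ_nonempty hsum
  exact ⟨Finset.univ.image f, Finset.card_image_le.trans (by simp), hf⟩

/-- There is a small set of vertices such that the sets it does not hit have small total size. -/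
theorem exists_hitting_set {ι : Type*} (S : ι → Finset V) {r : ℕ} (I : Finset ι) :
    ∃ R : Finset V, r * R.card ≤ I.card ∧
      ∑ i ∈ I.filter (fun i => Disjoint (S i) R), (S i).card ≤ Fintype.card V * r := by
  classical
  induction I using Finset.strongInduction with
  | H I ih =>
    -- Greedy choice: as long as some vertex lies in at least `r` of the remaining sets, take it and
    -- discard these sets. At the end every vertex lies in at most `r` sets. Nonemptiness matters
    -- only for `r = 0`, where it keeps the recursion decreasing.
    by_cases hv : ∃ v, r ≤ (I.filter fun i => v ∈ S i).card ∧ (I.filter fun i => v ∈ S i).Nonempty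
    · obtain ⟨v, hv, hne⟩ := hv
      have hsum := Finset.card_filter_add_card_filter_not (s := I) (fun i => v ∈ S i)
      have hss : I.filter (fun i => v ∉ S i) ⊂ I := by
        refine Finset.filter_ssubset.2 ?_
        obtain ⟨i, hi⟩ := hne
        rw [Finset.mem_filter] at hi
        exact ⟨i, hi.1, not_not.2 hi.2⟩
      obtain ⟨R, hR1, hR2⟩ := ih _ hss
      refine ⟨insert v R, ?_, ?_⟩
      · have := Finset.card_insert_le v R
        calc r * (insert v R).card ≤ r * (R.card + 1) := Nat.mul_le_mul_left _ this
          _ = r * R.card + r := by ring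
          _ ≤ I.card := by omega
      · refine le_trans (Finset.sum_le_sum_of_subset fun i hi => ?_) hR2
        simp only [Finset.mem_filter, Finset.disjoint_insert_right] at hi ⊢
        exact ⟨⟨hi.1, hi.2.1⟩, hi.2.2⟩
    · push Not at hv
      have hv' : ∀ v, (I.filter fun i => v ∈ S i).card ≤ r := by
        intro v
        by_contra! hc
        have := hv v hc.le
        rw [this] at hc
        simp at hc
      refine ⟨∅, by simp, ?_⟩
      calc ∑ i ∈ I.filter (fun i => Disjoint (S i) ∅), (S i).card
          = ∑ i ∈ I, ∑ v : V, if v ∈ S i then 1 else 0 := by simp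
        _ = ∑ v : V, (I.filter fun i => v ∈ S i).card := by
          rw [Finset.sum_comm]; simp only [Finset.card_filter]
        _ ≤ ∑ _v : V, r := Finset.sum_le_sum fun v _ => hv' v
        _ = _ := by simp

/-- If every edge of `E` is critical for some pair of `P` and at most two faults, then `E` is
small. -/
theorem card_le_of_critical {E P : Finset (V × V)} {r : ℕ} (hr : 1 ≤ r)
    (hPr : Fintype.card V * P.card ≤ r ^ 3)
    (hE : ∀ e ∈ E, ∃ p ∈ P, ∃ F : Finset (V × V), F.card ≤ 2 ∧ Critical E e p.1 p.2 F) :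
    E.card ≤ 163 * (Fintype.card V * r) := by
  classical
  rcases isEmpty_or_nonempty V with hV | hV
  · simp [Finset.eq_empty_of_isEmpty E]
  set n := Fintype.card V with hn
  -- If the target is not reachable, both routes are single vertices by default, so that injectivity
  -- holds for every `E` and `p`.
  have hroutes : ∀ (E : Finset (V × V)) (p : V × V), ∃ a b : Route V,
      Set.InjOn a.vtx (Set.Iic a.len) ∧ Set.InjOn b.vtx (Set.Iic b.len) ∧
      (Reach E p.1 p.2 → a.IsPath E p.1 p.2 ∧ b.IsPath E p.1 p.2 ∧
        ∀ e ∈ a.edges, e ∈ b.edges → ¬ Reach (E.erase e) p.1 p.2) := by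
    intro E p
    by_cases h : Reach E p.1 p.2
    · obtain ⟨a, b, ha, hb, hab⟩ := h.exists_two_routes
      exact ⟨a, b, ha.inj, hb.inj, fun _ => ⟨ha, hb, hab⟩⟩
    · exact ⟨⟨0, fun _ => p.1⟩, ⟨0, fun _ => p.1⟩, fun i hi j hj _ => (Nat.le_zero.1 hi).trans
        (Nat.le_zero.1 hj).symm, fun i hi j hj _ => (Nat.le_zero.1 hi).trans
        (Nat.le_zero.1 hj).symm, fun h' => absurd h' h⟩
  choose α β hα hβ hαβ using hroutes
  -- the first hitting set
  obtain ⟨R₁, hR₁, hpre⟩ := exists_short_prefixes (P ×ˢ (Finset.univ : Finset Bool))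
    (fun k => (α E k.1).len)
    -- Each path is read in both directions, so that its prefixes and its suffixes that miss `R₁`
    -- are short on average.
    (fun k i => if k.2 then (α E k.1).vtx i else (α E k.1).vtx ((α E k.1).len - i)) (by
      rintro ⟨p, b⟩ -
      cases b
      · intro i hi j hj hij
        simp only [Set.mem_Iic, Bool.false_eq_true, if_false] at hi hj hij
        have := hα E p (Set.mem_Iic.2 (Nat.sub_le _ _)) (Set.mem_Iic.2 (Nat.sub_le _ _)) hij
        omega
      · simpa using hα E p) r
  -- the indices of the edges of the first path of a pair before or after the hitting set
  let T : V × V → Finset ℕ := fun p => (Finset.range (α E p).len).filter fun i =>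
    (∀ j ≤ i, (α E p).vtx j ∉ R₁) ∨ ∀ j, i < j → j ≤ (α E p).len → (α E p).vtx j ∉ R₁
  -- The middle edges: along the path there are vertices of `R₁` on both sides.
  let M : V × V → Finset (V × V) := fun p =>
    (Finset.range (α E p).len \ T p).image fun i => ((α E p).vtx i, (α E p).vtx (i + 1))
  let X : V × V → ℕ → Finset (V × V) := fun p i =>
    E.erase ((α E p).vtx i, (α E p).vtx (i + 1))
  let conds : V × V → Finset (Route V) := fun p =>
    {α E p, β E p, α (E \ M p) p, β (E \ M p) p} ∪
      ((T p).image (fun i => α (X p i) p) ∪ (T p).image (fun i => β (X p i) p))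
  let I := P.biUnion conds
  have hT : ∑ p ∈ P, (T p).card ≤ 2 * r ^ 2 := by
    have h1 : ∑ p ∈ P, (T p).card ≤ ∑ k ∈ P ×ˢ (Finset.univ : Finset Bool),
        ((Finset.range ((α E k.1).len + 1)).filter fun i => ∀ j ≤ i,
          (if k.2 then (α E k.1).vtx j else (α E k.1).vtx ((α E k.1).len - j)) ∉ R₁).card := by
      rw [Finset.sum_product]
      refine Finset.sum_le_sum fun p _ => ?_
      simp only [Fintype.sum_bool, if_true, Bool.false_eq_true, if_false]
      have hsub : T p ⊆ ((Finset.range ((α E p).len + 1)).filter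
          fun i => ∀ j ≤ i, (α E p).vtx j ∉ R₁) ∪
          ((Finset.range ((α E p).len + 1)).filter fun i => ∀ j ≤ i,
            (α E p).vtx ((α E p).len - j) ∉ R₁).image fun i => (α E p).len - 1 - i := by
        intro i hi
        simp only [T, Finset.mem_filter, Finset.mem_range] at hi
        simp only [Finset.mem_union, Finset.mem_filter, Finset.mem_range, Finset.mem_image]
        rcases hi.2 with h | h
        · exact Or.inl ⟨by omega, h⟩
        · exact Or.inr ⟨(α E p).len - 1 - i, ⟨by omega, fun j hj => h _ (by omega) (by omega)⟩,
            by omega⟩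
      exact (Finset.card_le_card hsub).trans ((Finset.card_union_le _ _).trans
        (Nat.add_le_add_left Finset.card_image_le _))
    have h2 : (r + 1) * ∑ p ∈ P, (T p).card ≤ 2 * r ^ 3 := by
      refine (Nat.mul_le_mul_left _ h1).trans (hpre.trans ?_)
      rw [Finset.card_product, Finset.card_univ, Fintype.card_bool]
      nlinarith
    by_contra! hc
    have : 0 < r ^ 2 := pow_pos (by omega) 2
    nlinarith
  -- Combine `|P| ≤ n ^ 2` with `n |P| ≤ r ^ 3` to get `|P| ^ 3 ≤ (n |P|) ^ 2 ≤ r ^ 6`.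
  have hP2 : P.card ≤ r ^ 2 := by
    have h1 : P.card ≤ n ^ 2 := by
      refine P.card_le_univ.trans (le_of_eq ?_)
      rw [Fintype.card_prod, sq]
    refine (Nat.pow_le_pow_iff_left (n := 3) (by norm_num)).1 ?_
    calc P.card ^ 3 = P.card * P.card ^ 2 := by ring
      _ ≤ n ^ 2 * P.card ^ 2 := Nat.mul_le_mul_right _ h1
      _ = (n * P.card) ^ 2 := by ring
      _ ≤ (r ^ 3) ^ 2 := Nat.pow_le_pow_left hPr 2
      _ = (r ^ 2) ^ 3 := by ring
  have hI : I.card ≤ 8 * r ^ 2 := by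
    have h1 : ∀ p ∈ P, (conds p).card ≤ 4 + 2 * (T p).card := by
      intro p _
      refine (Finset.card_union_le _ _).trans (Nat.add_le_add Finset.card_le_four ?_)
      refine (Finset.card_union_le _ _).trans ?_
      have h1 : ((T p).image (fun i => α (X p i) p)).card ≤ _ := Finset.card_image_le
      have h2 : ((T p).image (fun i => β (X p i) p)).card ≤ _ := Finset.card_image_le
      omega
    calc I.card ≤ ∑ p ∈ P, (conds p).card := Finset.card_biUnion_le
      _ ≤ ∑ p ∈ P, (4 + 2 * (T p).card) := Finset.sum_le_sum h1
      _ = 4 * P.card + 2 * ∑ p ∈ P, (T p).card := by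
        rw [Finset.sum_add_distrib, ← Finset.mul_sum]; simp [mul_comm]
      _ ≤ 8 * r ^ 2 := by omega
  -- the second hitting set
  obtain ⟨R₂, hR₂, hunhit⟩ := exists_hitting_set (r := r) Route.verts I
  let R := R₁ ∪ R₂
  have hR : R.card ≤ 9 * r := by
    have h1 : R₂.card ≤ 8 * r := by
      by_contra! hc
      nlinarith
    have h2 : R.card ≤ R₁.card + R₂.card := Finset.card_union_le _ _
    omega
  let D : V → Finset (V × V) := fun v =>
    (E.filter fun e => ∃ (t : V) (F : Finset (V × V)), F.card ≤ 2 ∧ Critical E e v t F) ∪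
      E.filter fun e => ∃ (s : V) (F : Finset (V × V)), F.card ≤ 2 ∧ Critical E e s v F
  have hD : ∀ v ∈ R, (D v).card ≤ 18 * n := by
    intro v _
    refine (Finset.card_union_le _ _).trans ?_
    have h1 := card_critical_source_le (E := E) (s := v) (D := E.filter fun e =>
      ∃ (t : V) (F : Finset (V × V)), F.card ≤ 2 ∧ Critical E e v t F)
      fun e he => (Finset.mem_filter.1 he).2
    have h2 := card_critical_target_le (E := E) (t := v) (D := E.filter fun e =>
      ∃ (s : V) (F : Finset (V × V)), F.card ≤ 2 ∧ Critical E e s v F)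
      fun e he => (Finset.mem_filter.1 he).2
    omega
  have hcover : E ⊆ R.biUnion D ∪
      (I.filter fun p => Disjoint p.verts R₂).biUnion Route.edges := by
    intro e he
    obtain ⟨⟨s, t⟩, hst, F, hF, hcr⟩ := hE e he
    simp only at hcr
    by_cases hhit : ∃ v ∈ R, Reach (E \ F) s v ∧ Reach (E \ F) v t
    · obtain ⟨v, hv, h1, h2⟩ := hhit
      refine Finset.mem_union_left _ (Finset.mem_biUnion.2 ⟨v, hv, ?_⟩)
      rcases hcr.split h1 h2 with h | h
      · exact Finset.mem_union_right _ (Finset.mem_filter.2 ⟨he, s, F, hF, h⟩)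
      · exact Finset.mem_union_left _ (Finset.mem_filter.2 ⟨he, t, F, hF, h⟩)
    -- From here on no walk from `s` to `t` in `E \ F` meets `R`. A candidate that survives `F`
    -- therefore avoids `R₂`, and it must contain `e`.
    push Not at hhit
    have hdone : ∀ p ∈ conds (s, t), p.IsPath (E \ F) s t →
        e ∈ R.biUnion D ∪ (I.filter fun p => Disjoint p.verts R₂).biUnion Route.edges := by
      intro p hp hpath
      refine Finset.mem_union_right _ (Finset.mem_biUnion.2 ⟨p, Finset.mem_filter.2
        ⟨Finset.mem_biUnion.2 ⟨(s, t), hst, hp⟩, ?_⟩, ?_⟩)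
      · refine Finset.disjoint_left.2 fun v hv hvR => ?_
        obtain ⟨h1, h2⟩ := hpath.reach_of_mem_verts hv
        exact hhit v (Finset.mem_union_right _ hvR) h1 h2
      · by_contra hc
        refine hcr.2 (hpath.of_edges_subset fun b hb => Finset.mem_erase.2
          ⟨fun hbe => hc (by rwa [hbe] at hb), hpath.edges_subset hb⟩).reach
    have hpair : ∀ E' F' : Finset (V × V), α E' (s, t) ∈ conds (s, t) →
        β E' (s, t) ∈ conds (s, t) → F'.card ≤ 1 → E' \ F' ⊆ E \ F → Reach (E' \ F') s t →
        e ∈ R.biUnion D ∪ (I.filter fun p => Disjoint p.verts R₂).biUnion Route.edges := by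
      intro E' F' h1 h2 hF' hsub hreach
      obtain ⟨ha, hb, hab⟩ := hαβ E' (s, t) (hreach.mono Finset.sdiff_subset)
      rcases ha.survives hb hab hF' hreach with h | h
      · exact hdone _ h1 (h.of_edges_subset (h.edges_subset.trans hsub))
      · exact hdone _ h2 (h.of_edges_subset (h.edges_subset.trans hsub))
    obtain ⟨ha, hb, hab⟩ := hαβ E (s, t) (hcr.1.mono Finset.sdiff_subset)
    by_cases hFa : Disjoint (α E (s, t)).edges F
    · exact hdone _ (by simp [conds]) (ha.of_edges_subset
        (Finset.subset_sdiff.2 ⟨ha.edges_subset, hFa⟩))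
    by_cases hFb : Disjoint (β E (s, t)).edges F
    · exact hdone _ (by simp [conds]) (hb.of_edges_subset
        (Finset.subset_sdiff.2 ⟨hb.edges_subset, hFb⟩))
    obtain ⟨a, haA, haF⟩ := Finset.not_disjoint_iff.1 hFa
    obtain ⟨b, hbB, hbF⟩ := Finset.not_disjoint_iff.1 hFb
    -- A fault on both paths would be a bridge, but `F` does not disconnect `s` from `t`. So `F`
    -- consists of one edge `a` of the first path and one edge `b` of the second.
    have hbridge : ∀ c ∈ F, c ∈ (α E (s, t)).edges → c ∉ (β E (s, t)).edges := by
      intro c hcF hcA hcB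
      refine hab c hcA hcB (hcr.1.mono fun x hx => ?_)
      rw [Finset.mem_sdiff] at hx
      exact Finset.mem_erase.2 ⟨fun h => hx.2 (h ▸ hcF), hx.1⟩
    have hne : a ≠ b := by
      rintro rfl
      exact hbridge a haF haA hbB
    have honly : ∀ c ∈ F, c ∈ (α E (s, t)).edges → c = a := by
      intro c hcF hcA
      by_contra hca
      have hcb : c ≠ b := by
        rintro rfl
        exact hbridge c hcF hcA hbB
      have h3 : ({a, b, c} : Finset (V × V)).card = 3 :=
        Finset.card_eq_three.2 ⟨a, b, c, hne, Ne.symm hca, Ne.symm hcb, rfl⟩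
      have : ({a, b, c} : Finset (V × V)) ⊆ F := by
        intro x hx
        simp only [Finset.mem_insert, Finset.mem_singleton] at hx
        rcases hx with rfl | rfl | rfl <;> assumption
      have := Finset.card_le_card this
      omega
    obtain ⟨i, hi, hia⟩ := Route.mem_edges.1 haA
    by_cases hiT : i ∈ T (s, t)
    -- An end edge fails: it has been deleted from `X (s, t) i`, where only one fault remains.
    · refine hpair (X (s, t) i) (F.erase a) ?_ ?_ ?_ ?_ ?_
      · exact Finset.mem_union_right _ (Finset.mem_union_left _ (Finset.mem_image.2 ⟨i, hiT, rfl⟩))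
      · exact Finset.mem_union_right _ (Finset.mem_union_right _ (Finset.mem_image.2 ⟨i, hiT, rfl⟩))
      · rw [Finset.card_erase_of_mem haF]
        omega
      · intro c hc
        simp only [X, hia, Finset.mem_sdiff, Finset.mem_erase, not_and] at hc ⊢
        exact ⟨hc.1.2, fun hcF => hc.2 hc.1.1 hcF⟩
      · refine hcr.1.mono fun c hc => ?_
        simp only [X, hia, Finset.mem_sdiff, Finset.mem_erase, not_and] at hc ⊢
        exact ⟨⟨fun h => hc.2 (h ▸ haF), hc.1⟩, fun _ => hc.2⟩
    -- A middle edge fails: all middle edges can be deleted together with it, and outside of them at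
    -- most one fault remains.
    · have haM : a ∈ M (s, t) := Finset.mem_image.2
        ⟨i, Finset.mem_sdiff.2 ⟨Finset.mem_range.2 hi, hiT⟩, hia⟩
      have hsurv : ∀ k < (α E (s, t)).len, k ≠ i →
          ((α E (s, t)).vtx k, (α E (s, t)).vtx (k + 1)) ∈ E \ F := by
        intro k hk hki
        refine Finset.mem_sdiff.2 ⟨ha.mem k hk, fun hc => hki ?_⟩
        have := honly _ hc (Route.mem_edges.2 ⟨k, hk, rfl⟩)
        rw [← hia] at this
        exact ha.index_unique hk.le hi.le (Prod.mk.inj this).1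
      refine hpair (E \ M (s, t)) (F \ M (s, t)) (by simp [conds]) (by simp [conds]) ?_ ?_ ?_
      · have : F \ M (s, t) ⊆ F.erase a := by
          intro c hc
          rw [Finset.mem_sdiff] at hc
          exact Finset.mem_erase.2 ⟨fun h => hc.2 (h ▸ haM), hc.1⟩
        have := Finset.card_le_card this
        rw [Finset.card_erase_of_mem haF] at this
        omega
      · intro c hc
        simp only [Finset.mem_sdiff, not_and] at hc ⊢
        exact ⟨hc.1.1, fun hcF => hc.2 hcF hc.1.2⟩
      -- No surviving walk from `s` to `t` meets the tail of a middle edge. Since `a` is the only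
      -- fault on the first path, a tail before or at `a` could be reached along that path through
      -- an earlier vertex of `R₁`, and from a tail after `a` a later vertex of `R₁` could be
      -- reached; either way a walk from `s` to `t` would meet `R`.
      · refine Reach.mono (hcr.1.sdiff (M := M (s, t)) ?_) fun c hc => ?_
        · rintro _ hcM hsc hct
          obtain ⟨k, hk, rfl⟩ := Finset.mem_image.1 hcM
          simp only [T, Finset.mem_sdiff, Finset.mem_range, Finset.mem_filter, not_and, not_or,
            not_forall, not_not] at hk
          obtain ⟨hkl, hk⟩ := hk
          obtain ⟨⟨j, hjk, hj⟩, ⟨j', hkj', hj'l, hj'⟩⟩ := hk hkl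
          simp only at hsc hct
          by_cases hki : k ≤ i
          · refine hhit _ (Finset.mem_union_left _ hj) ?_ ?_
            · have := Route.reach_of_mem (p := α E (s, t)) (E := E \ F) (Nat.zero_le j)
                fun m _ hm => hsurv m (by omega) (by omega)
              rwa [ha.source] at this
            · exact (Route.reach_of_mem hjk fun m _ hm => hsurv m (by omega) (by omega)).trans hct
          · refine hhit _ (Finset.mem_union_left _ hj') ?_ ?_
            · exact hsc.trans
                (Route.reach_of_mem hkj'.le fun m hm' hm => hsurv m (by omega) (by omega))
            · have := Route.reach_of_mem (p := α E (s, t)) (E := E \ F) hj'l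
                fun m hm' hm => hsurv m (by omega) (by omega)
              rwa [ha.target] at this
        · simp only [Finset.mem_sdiff, not_and] at hc ⊢
          exact ⟨⟨hc.1.1, hc.2⟩, fun hcF => absurd hcF hc.1.2⟩
  have hedges : ((I.filter fun p => Disjoint p.verts R₂).biUnion Route.edges).card ≤ n * r := by
    refine (Finset.card_biUnion_le.trans (Finset.sum_le_sum fun p hp => ?_)).trans hunhit
    have hinj : Set.InjOn p.vtx (Set.Iic p.len) := by
      obtain ⟨p', -, hp'⟩ := Finset.mem_biUnion.1 (Finset.mem_filter.1 hp).1
      simp only [conds, Finset.mem_union, Finset.mem_insert, Finset.mem_singleton,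
        Finset.mem_image] at hp'
      rcases hp' with (rfl | rfl | rfl | rfl) | ⟨i, -, rfl⟩ | ⟨i, -, rfl⟩
      exacts [hα _ _, hβ _ _, hα _ _, hβ _ _, hα _ _, hβ _ _]
    rw [Route.card_verts hinj]
    exact p.card_edges_le.trans (Nat.le_succ _)
  have hfin := (Finset.card_le_card hcover).trans (Finset.card_union_le _ _)
  have hbi := Finset.card_biUnion_le_card_mul R D _ hD
  have : R.card * (18 * n) ≤ 9 * r * (18 * n) := Nat.mul_le_mul_right _ hR
  nlinarith

end Counting

end FTRS

/-! ### From critical edges to minimal preservers. -/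

namespace FTRS

section Preservers

variable {V : Type*}

theorem edges_deleteEdges (H : Digraph V) (F : Set (V × V)) :
    edges (deleteEdges H F) = edges H \ F := by
  ext e
  rfl

theorem reachable_iff_reach {H : Digraph V} {E : Finset (V × V)} (h : edges H = E) {s t : V} :
    Reachable H s t ↔ Reach E s t := by
  have : H.Adj = fun u v => (u, v) ∈ E := by
    funext u v
    have : (u, v) ∈ edges H ↔ (u, v) ∈ E := by rw [h]; rfl
    exact propext this
  rw [Reachable, this, Reach]

theorem Reachable.mono {H G : Digraph V} (h : ∀ u v, H.Adj u v → G.Adj u v) {s t : V}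
    (hr : Reachable H s t) : Reachable G s t := Relation.ReflTransGen.mono h _ _ hr

variable [Fintype V]

/-- A 2-fault-tolerant reachability preserver from which no edge can be deleted is small. -/
theorem ncard_edges_le_of_minimal {G H : Digraph V} {P : Finset (V × V)} (hH : IsFTRS 2 G P H)
    (hmin : ∀ e ∈ edges H, ¬ IsFTRS 2 G P (deleteEdges H {e})) :
    ((edges H).ncard : ℝ) ≤
      326 * (Fintype.card V : ℝ) ^ (4 / 3 : ℝ) * (P.card : ℝ) ^ (1 / 3 : ℝ) := by
  classical
  obtain ⟨E, hE⟩ : ∃ E : Finset (V × V), edges H = E := ⟨(edges H).toFinset, by simp⟩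
  have hcrit : ∀ e ∈ E, ∃ p ∈ P, ∃ F : Finset (V × V), F.card ≤ 2 ∧ Critical E e p.1 p.2 F := by
    intro e he
    have hn := hmin e (by rw [hE]; exact he)
    simp only [IsFTRS, not_and, not_forall] at hn
    obtain ⟨s, t, hst, F, hFG, hF, hiff⟩ := hn fun u v huv => hH.1 huv.1
    have h1 := hH.2 s t hst F hFG hF
    have e1 : edges (deleteEdges H F) = ((E \ F : Finset (V × V)) : Set (V × V)) := by
      rw [edges_deleteEdges, hE, Finset.coe_sdiff]
    have e2 : edges (deleteEdges (deleteEdges H {e}) F) =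
        (((E \ F).erase e : Finset (V × V)) : Set (V × V)) := by
      rw [edges_deleteEdges, edges_deleteEdges, hE, Finset.coe_erase, Finset.coe_sdiff]
      exact Set.sdiff_sdiff_comm
    rw [reachable_iff_reach e1] at h1
    rw [h1, reachable_iff_reach e2] at hiff
    refine ⟨(s, t), hst, F, hF, ?_⟩
    by_contra hc
    refine hiff ⟨fun h => ?_, fun h => h.mono (Finset.erase_subset _ _)⟩
    by_contra h'
    exact hc ⟨h, h'⟩
  have hcard : (edges H).ncard = E.card := by rw [hE, Set.ncard_coe_finset]
  rw [hcard]
  set n := Fintype.card V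
  rcases Nat.eq_zero_or_pos (n * P.card) with h0 | hpos
  · have : E = ∅ := by
      rw [Finset.eq_empty_iff_forall_notMem]
      intro e he
      obtain ⟨p, hp, -⟩ := hcrit e he
      rcases Nat.mul_eq_zero.1 h0 with h | h
      · exact (Fintype.card_eq_zero_iff.1 h).elim e.1
      · rw [Finset.card_eq_zero.1 h] at hp
        simp at hp
    rw [this]
    simp only [Finset.card_empty, Nat.cast_zero]
    positivity
  · have hn0 : (0 : ℝ) ≤ n := Nat.cast_nonneg _
    have hp0 : (0 : ℝ) ≤ P.card := Nat.cast_nonneg _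
    -- The count is applied with `r = ⌈y⌉₊`. Since `y ≥ 1`, rounding up at most doubles, which turns
    -- `163` into `326`.
    set y : ℝ := ((n * P.card : ℕ) : ℝ) ^ (1 / 3 : ℝ) with hy
    have hy1 : 1 ≤ y := Real.one_le_rpow (by exact_mod_cast hpos) (by norm_num)
    have hy3 : y ^ 3 = ((n * P.card : ℕ) : ℝ) := by
      rw [hy, ← Real.rpow_natCast, ← Real.rpow_mul (Nat.cast_nonneg _)]
      norm_num
    have hceil : y ≤ ⌈y⌉₊ := Nat.le_ceil y
    have hr1 : 1 ≤ ⌈y⌉₊ := by exact_mod_cast hy1.trans hceil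
    have hr2 : (⌈y⌉₊ : ℝ) ≤ 2 * y := by
      have := (Nat.ceil_lt_add_one (by linarith : 0 ≤ y)).le
      linarith
    have hr3 : n * P.card ≤ ⌈y⌉₊ ^ 3 := by
      have : ((n * P.card : ℕ) : ℝ) ≤ ((⌈y⌉₊ ^ 3 : ℕ) : ℝ) := by
        rw [← hy3]
        push_cast
        exact pow_le_pow_left₀ (by linarith) hceil 3
      exact_mod_cast this
    have hmain : (E.card : ℝ) ≤ 163 * (n * ⌈y⌉₊) := by
      exact_mod_cast card_le_of_critical hr1 hr3 hcrit
    have hpow : (n : ℝ) ^ (4 / 3 : ℝ) = n * (n : ℝ) ^ (1 / 3 : ℝ) := by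
      rcases hn0.eq_or_lt with h | h
      · rw [← h]; norm_num
      · rw [show (4 / 3 : ℝ) = 1 + 1 / 3 by norm_num, Real.rpow_add h, Real.rpow_one]
    have hyn : y = (n : ℝ) ^ (1 / 3 : ℝ) * (P.card : ℝ) ^ (1 / 3 : ℝ) := by
      rw [hy, Nat.cast_mul, Real.mul_rpow hn0 hp0]
    calc (E.card : ℝ) ≤ 163 * (n * ⌈y⌉₊) := hmain
      _ ≤ 163 * (n * (2 * y)) := by gcongr
      _ = _ := by rw [hyn, hpow]; ring

/-- A preserver with the fewest edges is minimal under deletion; `G` itself shows that there is one.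
-/
theorem exists_isFTRS_ncard_edges_le (G : Digraph V) (P : Finset (V × V)) :
    ∃ H : Digraph V, IsFTRS 2 G P H ∧ ((edges H).ncard : ℝ) ≤
      326 * (Fintype.card V : ℝ) ^ (4 / 3 : ℝ) * (P.card : ℝ) ^ (1 / 3 : ℝ) := by
  classical
  have hex : ∃ k, ∃ H : Digraph V, IsFTRS 2 G P H ∧ (edges H).ncard = k :=
    ⟨_, G, ⟨le_refl G, fun _ _ _ _ _ _ => Iff.rfl⟩, rfl⟩
  obtain ⟨H, hH, hk⟩ := Nat.find_spec hex
  refine ⟨H, hH, ncard_edges_le_of_minimal hH fun e he hdel => ?_⟩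
  refine Nat.find_min hex ?_ ⟨_, hdel, rfl⟩
  rw [← hk, edges_deleteEdges]
  exact Set.ncard_sdiff_singleton_lt_of_mem he (Set.toFinite _)

end Preservers

end FTRS

/-! ### A program logic with running times. -/

namespace FTRS

namespace RAM

/-- Started with `σ`, the program `p` halts after at most `B` steps, with a memory that
satisfies `Q`. -/
def Runs (p : Program) (σ : State) (B : ℕ) (Q : State → Prop) : Prop :=
  ∃ T τ, Exec p σ T τ ∧ T ≤ B ∧ Q τ

/-- The registers that a program may write. -/
def Program.regs : Program → Finset ℕ
  | .skip => ∅
  | .assign x _ => {x}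
  | .store _ _ _ _ => ∅
  | .seq p q => p.regs ∪ q.regs
  | .cond _ p q => p.regs ∪ q.regs
  | .loop _ p => p.regs

/-- The arrays that a program may write. -/
def Program.arrs : Program → Finset ℕ
  | .skip => ∅
  | .assign _ _ => ∅
  | .store a _ _ _ => {a}
  | .seq p q => p.arrs ∪ q.arrs
  | .cond _ p q => p.arrs ∪ q.arrs
  | .loop _ p => p.arrs

/-- The memories `σ` and `τ` differ at most in what `p` may write. -/
structure Frame (p : Program) (σ τ : State) : Prop where
  reg : ∀ y, y ∉ p.regs → τ.reg y = σ.reg y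
  arr : ∀ a, a ∉ p.arrs → τ.arr a = σ.arr a

theorem Frame.refl (p : Program) (σ : State) : Frame p σ σ := ⟨fun _ _ => rfl, fun _ _ => rfl⟩

theorem Frame.trans {p : Program} {σ τ ρ : State} (h : Frame p σ τ) (h' : Frame p τ ρ) :
    Frame p σ ρ :=
  ⟨fun y hy => (h'.reg y hy).trans (h.reg y hy), fun a ha => (h'.arr a ha).trans (h.arr a ha)⟩

theorem Frame.mono {p q : Program} {σ τ : State} (h : Frame p σ τ) (hr : p.regs ⊆ q.regs)
    (ha : p.arrs ⊆ q.arrs) : Frame q σ τ :=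
  ⟨fun y hy => h.reg y fun hc => hy (hr hc), fun a hn => h.arr a fun hc => hn (ha hc)⟩

/-- Invariants then need to mention only what a program changes; everything else is preserved by
inspection of its text. -/
theorem Exec.frame {p : Program} {σ τ : State} {T : ℕ} (h : Exec p σ T τ) : Frame p σ τ := by
  induction h with
  | skip σ => exact Frame.refl _ _
  | assign σ x e =>
    refine ⟨fun y hy => ?_, fun _ _ => rfl⟩
    have : y ≠ x := by simpa [Program.regs] using hy
    simp [State.setReg, this]
  | store σ a i j e =>
    refine ⟨fun _ _ => rfl, fun b hb => ?_⟩
    have : b ≠ a := by simpa [Program.arrs] using hb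
    funext k l
    simp [State.setCell, this]
  | seq _ _ ih1 ih2 =>
    exact (ih1.mono Finset.subset_union_left Finset.subset_union_left).trans
      (ih2.mono Finset.subset_union_right Finset.subset_union_right)
  | cond_true _ _ ih => exact ih.mono Finset.subset_union_left Finset.subset_union_left
  | cond_false _ _ ih => exact ih.mono Finset.subset_union_right Finset.subset_union_right
  | loop_true _ _ _ ih1 ih2 =>
    exact Frame.trans (ih1.mono (q := .loop _ _) (Finset.Subset.refl _) (Finset.Subset.refl _)) ih2
  | loop_false _ => exact Frame.refl _ _

theorem Runs.weaken {p : Program} {σ : State} {B B' : ℕ} {Q Q' : State → Prop}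
    (h : Runs p σ B Q) (hB : B ≤ B') (hQ : ∀ τ, Frame p σ τ → Q τ → Q' τ) : Runs p σ B' Q' := by
  obtain ⟨T, τ, h1, h2, h3⟩ := h
  exact ⟨T, τ, h1, h2.trans hB, hQ τ h1.frame h3⟩

theorem Runs.skip {σ : State} {B : ℕ} {Q : State → Prop} (h : Q σ) (hB : 1 ≤ B) :
    Runs .skip σ B Q := ⟨_, _, Exec.skip σ, hB, h⟩

theorem Runs.assign {σ : State} {x : ℕ} {e : Expr} {B : ℕ} {Q : State → Prop}
    (h : Q (σ.setReg x (e.eval σ))) (hB : e.cost + 1 ≤ B) : Runs (.assign x e) σ B Q :=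
  ⟨_, _, Exec.assign σ x e, hB, h⟩

theorem Runs.store {σ : State} {a : ℕ} {i j e : Expr} {B : ℕ} {Q : State → Prop}
    (h : Q (σ.setCell a (i.eval σ) (j.eval σ) (e.eval σ)))
    (hB : i.cost + j.cost + e.cost + 1 ≤ B) : Runs (.store a i j e) σ B Q :=
  ⟨_, _, Exec.store σ a i j e, hB, h⟩

theorem Runs.seq {p q : Program} {σ : State} {B C D : ℕ} {Q R : State → Prop}
    (hp : Runs p σ B Q) (hq : ∀ τ, Frame p σ τ → Q τ → Runs q τ C R) (hD : B + C ≤ D) :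
    Runs (.seq p q) σ D R := by
  obtain ⟨S, τ, h1, h2, h3⟩ := hp
  obtain ⟨T, ρ, h4, h5, h6⟩ := hq τ h1.frame h3
  exact ⟨S + T, ρ, h1.seq h4, by omega, h6⟩

theorem Runs.cond {e : Expr} {p q : Program} {σ : State} {B D : ℕ} {Q : State → Prop}
    (hp : e.eval σ ≠ 0 → Runs p σ B Q) (hq : e.eval σ = 0 → Runs q σ B Q)
    (hD : e.cost + 1 + B ≤ D) : Runs (.cond e p q) σ D Q := by
  by_cases h : e.eval σ = 0
  · obtain ⟨T, τ, h1, h2, h3⟩ := hq h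
    exact ⟨_, τ, Exec.cond_false h h1, by omega, h3⟩
  · obtain ⟨T, τ, h1, h2, h3⟩ := hp h
    exact ⟨_, τ, Exec.cond_true h h1, by omega, h3⟩

/-- Run `p` with the register `x` counting from `0` to below the content of the register `1`. -/
def forLoop (x : ℕ) (p : Program) : Program :=
  .seq (.assign x (.const 0))
    (.loop (.lt (.reg x) (.reg 1)) (.seq p (.assign x (.add (.reg x) (.const 1)))))

/-- A bound for the number of steps of `N` rounds of a loop with at most `B` steps per round. -/
def forCost (N B : ℕ) : ℕ := N * (B + 8) + 6

theorem setReg_reg_of_ne {σ : State} {x y v : ℕ} (h : y ≠ x) :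
    (σ.setReg x v).reg y = σ.reg y := by simp [State.setReg, h]

theorem setReg_reg_self {σ : State} {x v : ℕ} : (σ.setReg x v).reg x = v := by
  simp [State.setReg]

theorem setReg_arr {σ : State} {x v : ℕ} : (σ.setReg x v).arr = σ.arr := rfl

theorem frame_forLoop_setReg (x : ℕ) (p : Program) (σ : State) (v : ℕ) :
    Frame (forLoop x p) σ (σ.setReg x v) := by
  refine ⟨fun y hy => setReg_reg_of_ne ?_, fun _ _ => rfl⟩
  rintro rfl
  simp [forLoop, Program.regs] at hy

theorem Frame.forLoop {x : ℕ} {p : Program} {σ τ : State} (h : Frame p σ τ) :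
    Frame (forLoop x p) σ τ := by
  refine h.mono (fun y hy => ?_) (fun y hy => ?_)
  · simp [RAM.forLoop, Program.regs, hy]
  · simp [RAM.forLoop, Program.arrs, hy]

/-- The rule for counting loops with an invariant. -/
theorem Runs.forLoop {x : ℕ} {p : Program} {σ : State} {N B : ℕ} (hN : σ.reg 1 = N)
    (h1 : 1 ∉ (RAM.forLoop x p).regs) (hx : x ∉ p.regs) (I : ℕ → State → Prop)
    (hI0 : I 0 (σ.setReg x 0))
    (hstep : ∀ i < N, ∀ τ, I i τ → τ.reg x = i → Frame (RAM.forLoop x p) σ τ →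
      Runs p τ B fun τ' => I (i + 1) (τ'.setReg x (i + 1))) :
    Runs (RAM.forLoop x p) σ (forCost N B) (I N) := by
  -- Here `d` is the number of rounds left. Each round costs `4` for the test and `4` for the
  -- increment beyond the body, and the last, failing test costs another `4`.
  have key : ∀ d i τ, i + d = N → I i τ → τ.reg x = i → Frame (RAM.forLoop x p) σ τ →
      Runs (.loop (.lt (.reg x) (.reg 1)) (.seq p (.assign x (.add (.reg x) (.const 1)))))
        τ (d * (B + 8) + 4) (I N) := by
    intro d
    induction d with
    | zero =>
      intro i τ hi hIi hxi hfr
      have hiN : i = N := by omega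
      subst hiN
      refine ⟨_, τ, Exec.loop_false ?_, ?_, hIi⟩
      · simp [Expr.eval, hxi, hfr.reg 1 h1, hN]
      · simp [Expr.cost]
    | succ d ih =>
      intro i τ hi hIi hxi hfr
      obtain ⟨T, τ', h2, h3, h4⟩ := hstep i (by omega) τ hIi hxi hfr
      have hfr' := h2.frame
      have hval : (Expr.add (.reg x) (.const 1)).eval τ' = i + 1 := by
        simp [Expr.eval, hfr'.reg x hx, hxi]
      obtain ⟨T', ρ, h5, h6, h7⟩ := ih (i + 1) (τ'.setReg x (i + 1)) (by omega) h4
        setReg_reg_self ((hfr.trans hfr'.forLoop).trans (frame_forLoop_setReg _ _ _ _))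
      have hassign := Exec.assign τ' x (.add (.reg x) (.const 1))
      rw [hval] at hassign
      refine ⟨_, ρ, Exec.loop_true ?_ (h2.seq hassign) h5, ?_, h7⟩
      · have : i < N := by omega
        simp [Expr.eval, hxi, hfr.reg 1 h1, hN, this]
      · simp only [Expr.cost]
        rw [Nat.succ_mul]
        omega
  obtain ⟨T, τ, h2, h3, h4⟩ := key N 0 (σ.setReg x 0) (by omega) hI0 setReg_reg_self
    (frame_forLoop_setReg _ _ _ _)
  refine ⟨_, τ, (Exec.assign σ x (.const 0)).seq h2, ?_, h4⟩
  simp only [Expr.cost, forCost]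
  omega

/-- The rule for counting loops that search for a number with the property `φ`, and record
the success in the register `13`. -/
theorem Runs.search {x : ℕ} {p : Program} {σ : State} {N B : ℕ} {φ : ℕ → Prop}
    (hN : σ.reg 1 = N) (h1 : 1 ∉ (RAM.forLoop x p).regs) (hx : x ∉ p.regs) (h13 : 13 ≠ x)
    (hstep : ∀ i < N, ∀ τ, τ.reg x = i → Frame (RAM.forLoop x p) σ τ →
      Runs p τ B fun τ' => τ'.reg 13 ≠ 0 ↔ τ.reg 13 ≠ 0 ∨ φ i) :
    Runs (RAM.forLoop x p) σ (forCost N B)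
      fun τ => τ.reg 13 ≠ 0 ↔ σ.reg 13 ≠ 0 ∨ ∃ i < N, φ i := by
  refine Runs.forLoop hN h1 hx
    (fun k τ => τ.reg 13 ≠ 0 ↔ σ.reg 13 ≠ 0 ∨ ∃ i < k, φ i) ?_ ?_
  · simp [setReg_reg_of_ne h13]
  · intro i hi τ hτ hxi hfr
    refine (hstep i hi τ hxi hfr).weaken le_rfl fun τ' _ h => ?_
    rw [setReg_reg_of_ne h13, h, hτ, or_assoc]
    refine or_congr_right ⟨?_, ?_⟩
    · rintro (⟨j, hj, hφ⟩ | hφ)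
      · exact ⟨j, by omega, hφ⟩
      · exact ⟨i, by omega, hφ⟩
    · rintro ⟨j, hj, hφ⟩
      rcases Nat.lt_succ_iff_lt_or_eq.1 hj with h | rfl
      · exact Or.inl ⟨j, h, hφ⟩
      · exact Or.inr hφ

/-- Conjunction of conditions. -/
def Expr.and (e f : Expr) : Expr :=
  .lt (.const 1) (.add (.lt (.const 0) e) (.lt (.const 0) f))

/-- Negation of a condition. -/
def Expr.not (e : Expr) : Expr := .eq e (.const 0)

theorem Expr.eval_and {e f : Expr} {σ : State} :
    (e.and f).eval σ ≠ 0 ↔ e.eval σ ≠ 0 ∧ f.eval σ ≠ 0 := by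
  by_cases he : e.eval σ = 0 <;> by_cases hf : f.eval σ = 0 <;>
    simp [Expr.and, Expr.eval, he, hf, Nat.pos_of_ne_zero]

theorem Expr.eval_not {e : Expr} {σ : State} : e.not.eval σ ≠ 0 ↔ ¬ e.eval σ ≠ 0 := by
  by_cases he : e.eval σ = 0 <;> simp [Expr.not, Expr.eval, he]

theorem Expr.eval_eq {e f : Expr} {σ : State} :
    (Expr.eq e f).eval σ ≠ 0 ↔ e.eval σ = f.eval σ := by
  simp [Expr.eval]

end RAM

end FTRS

/-! ### Computing reachability, and the test for violations. -/

namespace FTRS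

namespace RAM

open Relation

/-- The elements that are at most `k` steps of `r` away from `s`. -/
def level {α : Type*} (r : α → α → Prop) (s : α) : ℕ → α → Prop
  | 0, v => v = s
  | k + 1, v => level r s k v ∨ ∃ u, level r s k u ∧ r u v

theorem level_mono {α : Type*} {r : α → α → Prop} {s v : α} {k l : ℕ} (hkl : k ≤ l)
    (h : level r s k v) : level r s l v := by
  induction l, hkl using Nat.le_induction with
  | base => exact h
  | succ l _ ih => exact Or.inl ih

/-- If `r` relates only numbers below `N`, then whatever can be reached from `s` can be reached
in `N` steps. -/
theorem level_of_reflTransGen {r : ℕ → ℕ → Prop} {s v N : ℕ} (hs : s < N)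
    (hr : ∀ u v, r u v → u < N ∧ v < N) (h : ReflTransGen r s v) : level r s N v := by
  obtain ⟨l, x, h0, hl, hx, hinj⟩ := exists_injOn_of_reflTransGen h
  have hlev : ∀ i ≤ l, level r s i (x i) := by
    intro i
    induction i with
    | zero => exact fun _ => h0
    | succ i ih => exact fun hi => Or.inr ⟨x i, ih (by omega), hx i (by omega)⟩
  have hlt : ∀ i ≤ l, x i < N := by
    rintro (_ | i) hi
    · rwa [h0]
    · exact (hr _ _ (hx i (by omega))).2
  -- The `l + 1` entries of the sequence are distinct numbers below `N`.
  have hcard : l + 1 ≤ N := by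
    have := Finset.card_le_card_of_injOn (s := Finset.range (l + 1)) (t := Finset.range N) x
      (fun i hi => by
        have hi' : i < l + 1 := by simpa using hi
        simpa using hlt i (by omega))
      (fun i hi j hj hij => hinj
        (by have hi' : i < l + 1 := by simpa using hi
            exact Set.mem_Iic.2 (by omega))
        (by have hj' : j < l + 1 := by simpa using hj
            exact Set.mem_Iic.2 (by omega)) hij)
    simpa using this
  have := hlev l le_rfl
  rw [hl] at this
  exact level_mono (by omega) this

/-- The graph with adjacency matrix `A` after the deletion of two edges. -/
def aliveRel (A : ℕ → ℕ → ℕ) (a₁ b₁ a₂ b₂ u v : ℕ) : Prop :=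
  A u v ≠ 0 ∧ ¬ (u = a₁ ∧ v = b₁) ∧ ¬ (u = a₂ ∧ v = b₂)

/-- The test whether the edge given by the registers `10` and `11` is in the array `g`, and not
among the two edges given by the registers `4`, `5` and `6`, `7`. -/
def alive (g : ℕ) : Expr :=
  .and (.cell g (.reg 10) (.reg 11))
    (.and (.not (.and (.eq (.reg 10) (.reg 4)) (.eq (.reg 11) (.reg 5))))
      (.not (.and (.eq (.reg 10) (.reg 6)) (.eq (.reg 11) (.reg 7)))))

theorem eval_alive {g : ℕ} {σ : State} : (alive g).eval σ ≠ 0 ↔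
    aliveRel (σ.arr g) (σ.reg 4) (σ.reg 5) (σ.reg 6) (σ.reg 7) (σ.reg 10) (σ.reg 11) := by
  simp only [alive, aliveRel, Expr.eval_and, Expr.eval_not, Expr.eval_eq]
  rfl

/-- Mark the vertex in the register `11` in the array `m` if it is the head of an edge whose tail,
the vertex in the register `10`, is marked. -/
def relax (g m : ℕ) : Program :=
  .cond (.and (.cell m (.const 0) (.reg 10)) (alive g))
    (.store m (.const 0) (.reg 11) (.const 1)) .skip

/-- Mark the vertices that can be reached from the vertex in the register `8`. -/
def closure (g m : ℕ) : Program :=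
  .seq (forLoop 11 (.store m (.const 0) (.reg 11) (.eq (.reg 11) (.reg 8))))
    (forLoop 9 (forLoop 10 (forLoop 11 (relax g m))))

/-- A bound for the number of steps of `closure`. -/
def closureCost (N : ℕ) : ℕ := forCost N 10 + forCost N (forCost N (forCost N 100))

/-- The marks `M` are sound, and contain everything that is at most `k` steps away from `s`, or
one step further by an edge that comes before `(i, j)`. -/
structure MarkInv (r : ℕ → ℕ → Prop) (s N k i j : ℕ) (M : ℕ → ℕ) : Prop where
  sound : ∀ v < N, M v ≠ 0 → ReflTransGen r s v
  complete : ∀ v, level r s k v → M v ≠ 0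
  edge : ∀ u v, level r s k u → r u v → u < i ∨ u = i ∧ v < j → M v ≠ 0

/-- The part of the memory that determines a graph with two edges deleted. -/
structure GraphIn (g N : ℕ) (A : ℕ → ℕ → ℕ) (a₁ b₁ a₂ b₂ : ℕ) (σ : State) : Prop where
  bound : σ.reg 1 = N
  graph : σ.arr g = A
  reg4 : σ.reg 4 = a₁
  reg5 : σ.reg 5 = b₁
  reg6 : σ.reg 6 = a₂
  reg7 : σ.reg 7 = b₂

theorem GraphIn.frame {g N : ℕ} {A : ℕ → ℕ → ℕ} {a₁ b₁ a₂ b₂ : ℕ} {σ τ : State} {p : Program}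
    (h : GraphIn g N A a₁ b₁ a₂ b₂ σ) (hf : Frame p σ τ) (hp : ∀ y ∈ p.regs, 8 ≤ y)
    (hg : g ∉ p.arrs) : GraphIn g N A a₁ b₁ a₂ b₂ τ := by
  have hr : ∀ y < 8, τ.reg y = σ.reg y := fun y hy => hf.reg y fun hc => by
    have := hp y hc; omega
  exact ⟨(hr 1 (by norm_num)).trans h.bound, (hf.arr g hg).trans h.graph,
    (hr 4 (by norm_num)).trans h.reg4, (hr 5 (by norm_num)).trans h.reg5,
    (hr 6 (by norm_num)).trans h.reg6, (hr 7 (by norm_num)).trans h.reg7⟩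

section Closure

variable {g m N : ℕ} {A : ℕ → ℕ → ℕ} {a₁ b₁ a₂ b₂ s : ℕ} {σ : State}

/-- Marks are updated in place, so one round may mark vertices more than one step further away. For
this reason `MarkInv` bounds the marks from below by levels, and from above only by reachability. -/
theorem runs_relax (hσ : GraphIn g N A a₁ b₁ a₂ b₂ σ) {k i j : ℕ} (hi : σ.reg 10 = i)
    (hj : σ.reg 11 = j) (hiN : i < N)
    (hinv : MarkInv (aliveRel A a₁ b₁ a₂ b₂) s N k i j (σ.arr m 0)) :
    Runs (relax g m) σ 100
      fun τ => MarkInv (aliveRel A a₁ b₁ a₂ b₂) s N k i (j + 1) (τ.arr m 0) := by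
  have hcond : (Expr.and (.cell m (.const 0) (.reg 10)) (alive g)).eval σ ≠ 0 ↔
      σ.arr m 0 i ≠ 0 ∧ aliveRel A a₁ b₁ a₂ b₂ i j := by
    rw [Expr.eval_and, eval_alive, hσ.graph, hσ.reg4, hσ.reg5, hσ.reg6, hσ.reg7, hi, hj, ← hi]
    rfl
  refine Runs.cond (B := 10) (fun h => Runs.store ?_ (by simp [Expr.cost]))
    (fun h => Runs.skip ?_ (by norm_num)) (by simp [Expr.cost, alive, Expr.and, Expr.not])
  · obtain ⟨h1, h2⟩ := hcond.1 h
    have hM : ∀ v, (σ.setCell m ((Expr.const 0).eval σ) ((Expr.reg 11).eval σ)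
        ((Expr.const 1).eval σ)).arr m 0 v = if v = j then 1 else σ.arr m 0 v := by
      intro v
      simp [State.setCell, Expr.eval, hj]
    refine ⟨fun v hv hm => ?_, fun v hv => ?_, fun u v hu huv huij => ?_⟩
    · rw [hM] at hm
      split_ifs at hm with hvj
      · subst hvj
        exact (hinv.sound i hiN h1).tail h2
      · exact hinv.sound v hv hm
    · rw [hM]
      split_ifs
      · exact one_ne_zero
      · exact hinv.complete v hv
    · rw [hM]
      split_ifs with hvj
      · exact one_ne_zero
      · exact hinv.edge u v hu huv (by omega)
  · refine ⟨hinv.sound, hinv.complete, fun u v hu huv huij => ?_⟩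
    by_cases hc : u = i ∧ v = j
    · obtain ⟨rfl, rfl⟩ := hc
      exact absurd h (hcond.2 ⟨hinv.complete u hu, huv⟩)
    · exact hinv.edge u v hu huv (by omega)

theorem runs_relax_row (hgm : g ≠ m) (hσ : GraphIn g N A a₁ b₁ a₂ b₂ σ) {k i : ℕ}
    (hi : σ.reg 10 = i) (hiN : i < N)
    (hinv : MarkInv (aliveRel A a₁ b₁ a₂ b₂) s N k i 0 (σ.arr m 0)) :
    Runs (forLoop 11 (relax g m)) σ (forCost N 100)
      fun τ => MarkInv (aliveRel A a₁ b₁ a₂ b₂) s N k i N (τ.arr m 0) := by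
  refine Runs.forLoop hσ.bound (by simp [forLoop, relax, Program.regs])
    (by simp [relax, Program.regs])
    (fun j τ => MarkInv (aliveRel A a₁ b₁ a₂ b₂) s N k i j (τ.arr m 0)) hinv ?_
  intro j hj τ hτ hτj hfr
  exact runs_relax (hσ.frame hfr (by simp [forLoop, relax, Program.regs])
    (by simp [forLoop, relax, Program.arrs, hgm]))
    ((hfr.reg 10 (by simp [forLoop, relax, Program.regs])).trans hi) hτj hiN hτ

theorem runs_relax_all (hgm : g ≠ m) (hσ : GraphIn g N A a₁ b₁ a₂ b₂ σ)
    (hA : ∀ u v, A u v ≠ 0 → u < N ∧ v < N) {k : ℕ}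
    (hinv : MarkInv (aliveRel A a₁ b₁ a₂ b₂) s N k 0 0 (σ.arr m 0)) :
    Runs (forLoop 10 (forLoop 11 (relax g m))) σ (forCost N (forCost N 100))
      fun τ => MarkInv (aliveRel A a₁ b₁ a₂ b₂) s N (k + 1) 0 0 (τ.arr m 0) := by
  refine (Runs.forLoop (N := N) hσ.bound (by simp [forLoop, relax, Program.regs])
    (by simp [forLoop, relax, Program.regs])
    (fun i τ => MarkInv (aliveRel A a₁ b₁ a₂ b₂) s N k i 0 (τ.arr m 0)) hinv ?_).weaken le_rfl ?_
  · intro i hi τ hτ hτi hfr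
    refine (runs_relax_row hgm (hσ.frame hfr (by simp [forLoop, relax, Program.regs])
      (by simp [forLoop, relax, Program.arrs, hgm])) hτi hi hτ).weaken le_rfl fun τ' _ h => ?_
    refine ⟨h.sound, h.complete, fun u v hu huv huij => h.edge u v hu huv ?_⟩
    have := (hA u v huv.1).2
    omega
  · intro τ _ h
    refine ⟨h.sound, ?_, by simp⟩
    rintro v (hv | ⟨u, hu, huv⟩)
    · exact h.complete v hv
    · exact h.edge u v hu huv (Or.inl (hA u v huv.1).1)

/-- The first loop overwrites the marks left by earlier runs, and only below `N`, which is why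
nothing is claimed beyond. Each of the `N` rounds then gains one level, and `level_of_reflTransGen`
says that `N` levels suffice. -/
theorem runs_closure (hgm : g ≠ m) (hσ : GraphIn g N A a₁ b₁ a₂ b₂ σ)
    (hA : ∀ u v, A u v ≠ 0 → u < N ∧ v < N) (hs : σ.reg 8 = s) (hsN : s < N) :
    Runs (closure g m) σ (closureCost N) fun τ =>
      ∀ v < N, τ.arr m 0 v ≠ 0 ↔ ReflTransGen (aliveRel A a₁ b₁ a₂ b₂) s v := by
  refine Runs.seq (B := forCost N 10) (C := forCost N (forCost N (forCost N 100)))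
    (Q := fun τ => ∀ v < N, τ.arr m 0 v = if v = s then 1 else 0) ?_ ?_ le_rfl
  · refine Runs.forLoop hσ.bound (by simp [forLoop, Program.regs]) (by simp [Program.regs])
      (fun j τ => ∀ v < j, τ.arr m 0 v = if v = s then 1 else 0) (by simp) ?_
    intro j hj τ hτ hτj hfr
    refine Runs.store (fun v hv => ?_) (by simp [Expr.cost])
    have h8 : τ.reg 8 = s := (hfr.reg 8 (by simp [forLoop, Program.regs])).trans hs
    simp only [State.setReg, State.setCell, Expr.eval, hτj, h8, true_and]
    by_cases h1 : v = j
    · simp [h1]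
    · simpa [h1] using hτ v (by omega)
  · intro τ hfr hτ
    have hτ' := hσ.frame hfr (by simp [forLoop, Program.regs])
      (by simp [forLoop, Program.arrs, hgm])
    refine (Runs.forLoop (N := N) hτ'.bound (by simp [forLoop, relax, Program.regs])
      (by simp [forLoop, relax, Program.regs])
      (fun k τ => MarkInv (aliveRel A a₁ b₁ a₂ b₂) s N k 0 0 (τ.arr m 0)) ?_ ?_).weaken le_rfl ?_
    · refine ⟨fun v hv hm => ?_, ?_, by simp⟩
      · rw [setReg_arr, hτ v hv] at hm
        split_ifs at hm with h
        · rw [h]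
        · simp at hm
      · rintro v rfl
        rw [setReg_arr, hτ v hsN]
        simp
    · intro k hk ρ hρ _ hfr'
      exact runs_relax_all hgm (hτ'.frame hfr' (by simp [forLoop, relax, Program.regs])
        (by simp [forLoop, relax, Program.arrs, hgm])) hA hρ
    · intro ρ _ hρ v hv
      exact ⟨hρ.sound v hv, fun h => hρ.complete v
        (level_of_reflTransGen hsN (fun u v huv => hA u v huv.1) h)⟩

end Closure

/-- A pair of `P` and two faults which show that `H` is not a preserver of `A`. -/
def Violation (A P H : ℕ → ℕ → ℕ) (a₁ b₁ a₂ b₂ s t : ℕ) : Prop :=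
  P s t ≠ 0 ∧ ReflTransGen (aliveRel A a₁ b₁ a₂ b₂) s t ∧
    ¬ ReflTransGen (aliveRel H a₁ b₁ a₂ b₂) s t

/-- There is a violation by numbers below `N`. -/
def Violated (N : ℕ) (A P H : ℕ → ℕ → ℕ) : Prop :=
  ∃ a₁ < N, ∃ b₁ < N, ∃ a₂ < N, ∃ b₂ < N, ∃ s < N, ∃ t < N, Violation A P H a₁ b₁ a₂ b₂ s t

/-- The search for a violation by the source in the register `8` and the faults in the registers
`4`, `5` and `6`, `7`. -/
def scan : Program :=
  .seq (closure 0 3) (.seq (closure 2 4) (forLoop 12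
    (.cond (.and (.cell 1 (.reg 8) (.reg 12)) (.and (.cell 3 (.const 0) (.reg 12))
      (.not (.cell 4 (.const 0) (.reg 12))))) (.assign 13 (.const 1)) .skip)))

/-- The search for a violation; the register `13` tells whether there is one. -/
def check : Program :=
  .seq (.assign 13 (.const 0)) (forLoop 4 (forLoop 5 (forLoop 6 (forLoop 7 (forLoop 8 scan)))))

/-- A bound for the number of steps of `scan`. -/
def scanCost (N : ℕ) : ℕ := closureCost N + (closureCost N + forCost N 100)

/-- A bound for the number of steps of `check`. -/
def checkCost (N : ℕ) : ℕ :=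
  2 + forCost N (forCost N (forCost N (forCost N (forCost N (scanCost N)))))

/-- The register `1` bounds the vertices of the graphs in the arrays `0` and `2`. -/
structure Bounded (N : ℕ) (σ : State) : Prop where
  bound : σ.reg 1 = N
  arr0 : ∀ u v, σ.arr 0 u v ≠ 0 → u < N ∧ v < N
  arr2 : ∀ u v, σ.arr 2 u v ≠ 0 → u < N ∧ v < N

theorem runs_scan {N : ℕ} {σ : State} (hσ : Bounded N σ) (hs : σ.reg 8 < N) :
    Runs scan σ (scanCost N) fun τ => τ.reg 13 ≠ 0 ↔ σ.reg 13 ≠ 0 ∨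
      ∃ t < N, Violation (σ.arr 0) (σ.arr 1) (σ.arr 2) (σ.reg 4) (σ.reg 5) (σ.reg 6) (σ.reg 7)
        (σ.reg 8) t := by
  refine Runs.seq (runs_closure (by norm_num) ⟨hσ.bound, rfl, rfl, rfl, rfl, rfl⟩ hσ.arr0 rfl hs)
    (R := _) (fun τ hτ h0 => ?_) le_rfl
  have hreg : ∀ y, y ≠ 9 → y ≠ 10 → y ≠ 11 → τ.reg y = σ.reg y := fun y h1 h2 h3 =>
    hτ.reg y (by simp [closure, forLoop, relax, Program.regs, h1, h2, h3])
  have harr : ∀ a, a ≠ 3 → τ.arr a = σ.arr a := fun a h =>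
    hτ.arr a (by simp [closure, forLoop, relax, Program.arrs, h])
  refine Runs.seq (runs_closure (g := 2) (m := 4) (by norm_num) ⟨(hreg 1 (by norm_num)
    (by norm_num) (by norm_num)).trans hσ.bound, harr 2 (by norm_num), rfl, rfl, rfl, rfl⟩
    hσ.arr2 (hreg 8 (by norm_num) (by norm_num) (by norm_num)) hs) (R := _)
    (fun ρ hρ h2 => ?_) le_rfl
  have hreg' : ∀ y, y ≠ 9 → y ≠ 10 → y ≠ 11 → ρ.reg y = τ.reg y := fun y h1 h2 h3 =>
    hρ.reg y (by simp [closure, forLoop, relax, Program.regs, h1, h2, h3])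
  have harr' : ∀ a, a ≠ 4 → ρ.arr a = τ.arr a := fun a h =>
    hρ.arr a (by simp [closure, forLoop, relax, Program.arrs, h])
  have hreg'' : ∀ y, y ≠ 9 → y ≠ 10 → y ≠ 11 → ρ.reg y = σ.reg y := fun y h1 h2 h3 =>
    (hreg' y h1 h2 h3).trans (hreg y h1 h2 h3)
  rw [hreg 4 (by norm_num) (by norm_num) (by norm_num), hreg 5 (by norm_num) (by norm_num)
    (by norm_num), hreg 6 (by norm_num) (by norm_num) (by norm_num), hreg 7 (by norm_num)
    (by norm_num) (by norm_num)] at h2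
  rw [← hreg'' 13 (by norm_num) (by norm_num) (by norm_num)]
  refine Runs.search (N := N) ((hreg'' 1 (by norm_num) (by norm_num) (by norm_num)).trans hσ.bound)
    (by simp [forLoop, Program.regs]) (by simp [Program.regs]) (by norm_num) ?_
  intro t ht θ hθt hθ
  have hcond : (Expr.and (.cell 1 (.reg 8) (.reg 12)) (.and (.cell 3 (.const 0) (.reg 12))
      (.not (.cell 4 (.const 0) (.reg 12))))).eval θ ≠ 0 ↔ Violation (σ.arr 0) (σ.arr 1)
      (σ.arr 2) (σ.reg 4) (σ.reg 5) (σ.reg 6) (σ.reg 7) (σ.reg 8) t := by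
    have e1 : θ.arr 1 = σ.arr 1 := (hθ.arr 1 (by simp [forLoop, Program.arrs])).trans
      ((harr' 1 (by norm_num)).trans (harr 1 (by norm_num)))
    have e3 : θ.arr 3 = τ.arr 3 := (hθ.arr 3 (by simp [forLoop, Program.arrs])).trans
      (harr' 3 (by norm_num))
    have e4 : θ.arr 4 = ρ.arr 4 := hθ.arr 4 (by simp [forLoop, Program.arrs])
    have e8 : θ.reg 8 = σ.reg 8 := (hθ.reg 8 (by simp [forLoop, Program.regs])).trans
      (hreg'' 8 (by norm_num) (by norm_num) (by norm_num))
    rw [Expr.eval_and, Expr.eval_and, Expr.eval_not]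
    simp only [Expr.eval, e1, e3, e4, e8, hθt]
    rw [h0 t ht, h2 t ht]
    rfl
  refine Runs.cond (B := 10) (fun h => Runs.assign ?_ (by simp [Expr.cost]))
    (fun h => Runs.skip ?_ (by norm_num)) (by simp [Expr.cost, Expr.and, Expr.not])
  · simp [State.setReg, Expr.eval, hcond.1 h]
  · have : ¬ Violation (σ.arr 0) (σ.arr 1) (σ.arr 2) (σ.reg 4) (σ.reg 5) (σ.reg 6) (σ.reg 7)
        (σ.reg 8) t := fun hv => hcond.2 hv h
    simp [this]

/-- A search over all values of the register `x`. -/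
theorem runs_search_loop {x N B : ℕ} {p : Program} {Φ : State → Prop} (hx : 2 ≤ x) (hx' : x < 13)
    (hregs : ∀ y ∈ p.regs, x < y) (harrs : ∀ a ∈ p.arrs, 3 ≤ a)
    (hΦ : ∀ σ τ : State, (∀ a < 3, τ.arr a = σ.arr a) → (∀ y ≤ x, τ.reg y = σ.reg y) →
      (Φ τ ↔ Φ σ))
    (h : ∀ σ, Bounded N σ → σ.reg x < N →
      Runs p σ B fun τ => τ.reg 13 ≠ 0 ↔ σ.reg 13 ≠ 0 ∨ Φ σ)
    (σ : State) (hσ : Bounded N σ) :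
    Runs (forLoop x p) σ (forCost N B) fun τ => τ.reg 13 ≠ 0 ↔ σ.reg 13 ≠ 0 ∨
      ∃ i < N, Φ (σ.setReg x i) := by
  have hregs' : ∀ y ∈ (forLoop x p).regs, x ≤ y := by
    intro y hy
    simp only [forLoop, Program.regs, Finset.mem_union, Finset.mem_singleton] at hy
    rcases hy with rfl | hy | rfl
    · exact le_rfl
    · exact (hregs y hy).le
    · exact le_rfl
  have harrs' : ∀ a ∈ (forLoop x p).arrs, 3 ≤ a := by
    intro a ha
    exact harrs a (by simpa [forLoop, Program.arrs] using ha)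
  refine Runs.search hσ.bound (fun hc => by have := hregs' 1 hc; omega)
    (fun hc => lt_irrefl _ (hregs x hc)) (by omega) fun i hi τ hτ hfr => ?_
  have e : ∀ y < x, τ.reg y = σ.reg y := fun y hy =>
    hfr.reg y fun hc => by have := hregs' y hc; omega
  have e' : ∀ a < 3, τ.arr a = σ.arr a := fun a ha =>
    hfr.arr a fun hc => by have := harrs' a hc; omega
  have hτB : Bounded N τ := ⟨(e 1 (by omega)).trans hσ.bound, by
    rw [e' 0 (by norm_num)]; exact hσ.arr0, by rw [e' 2 (by norm_num)]; exact hσ.arr2⟩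
  refine (h τ hτB (by omega)).weaken le_rfl fun τ' _ hτ' => ?_
  rw [hτ', hΦ (σ.setReg x i) τ e']
  intro y hy
  by_cases hyx : y = x
  · subst hyx
    rw [hτ, setReg_reg_self]
  · rw [setReg_reg_of_ne hyx, e y (by omega)]

/-- Every loop adds one quantifier: it turns a property `Φ σ` into `∃ i < N, Φ (σ.setReg x i)`,
which depends on the counters of the outer loops only through lower registers. Five loops around
`scan` produce the quantifiers of `Violated` over faults and sources. -/
theorem runs_check {N : ℕ} {σ : State} (hσ : Bounded N σ) :
    Runs check σ (checkCost N) fun τ =>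
      τ.reg 13 ≠ 0 ↔ Violated N (σ.arr 0) (σ.arr 1) (σ.arr 2) := by
  have h8 := runs_search_loop (x := 8) (N := N) (B := scanCost N) (p := scan)
    (Φ := fun σ => ∃ t < N, Violation (σ.arr 0) (σ.arr 1) (σ.arr 2) (σ.reg 4) (σ.reg 5)
      (σ.reg 6) (σ.reg 7) (σ.reg 8) t) (by norm_num) (by norm_num) (by decide) (by decide)
    (fun σ τ ha hr => by simp [ha, hr]) (fun σ hσ hs => runs_scan hσ hs)
  have h7 := runs_search_loop (x := 7) (N := N) (by norm_num) (by norm_num) (by decide) (by decide)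
    (fun σ τ ha hr => by simp [State.setReg, ha, hr]) fun σ hσ _ => h8 σ hσ
  have h6 := runs_search_loop (x := 6) (N := N) (by norm_num) (by norm_num) (by decide) (by decide)
    (fun σ τ ha hr => by simp [State.setReg, ha, hr]) fun σ hσ _ => h7 σ hσ
  have h5 := runs_search_loop (x := 5) (N := N) (by norm_num) (by norm_num) (by decide) (by decide)
    (fun σ τ ha hr => by simp [State.setReg, ha, hr]) fun σ hσ _ => h6 σ hσ
  have h4 := runs_search_loop (x := 4) (N := N) (by norm_num) (by norm_num) (by decide) (by decide)
    (fun σ τ ha hr => by simp [State.setReg, ha, hr]) fun σ hσ _ => h5 σ hσ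
  have hσ' : Bounded N (σ.setReg 13 0) := ⟨hσ.bound, hσ.arr0, hσ.arr2⟩
  refine Runs.seq (B := 2) (Q := fun τ => τ = σ.setReg 13 0) (Runs.assign rfl (by simp [Expr.cost]))
    (fun τ _ hτ => ?_) le_rfl
  subst hτ
  refine (h4 _ hσ').weaken le_rfl fun τ _ h => ?_
  rw [h, setReg_reg_self]
  simp only [ne_eq, not_true_eq_false, false_or]
  rfl

end RAM

end FTRS

/-! ### Reverse deletion and its running time. -/

namespace FTRS

namespace RAM

open Relation

/-- The matrix `H` with the entry `(u, v)` replaced by zero. -/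
def clear (H : ℕ → ℕ → ℕ) (u v : ℕ) : ℕ → ℕ → ℕ :=
  fun k l => if k = u ∧ l = v then 0 else H k l

theorem clear_ne_zero {H : ℕ → ℕ → ℕ} {u v k l : ℕ} :
    clear H u v k l ≠ 0 ↔ ¬ (k = u ∧ l = v) ∧ H k l ≠ 0 := by
  unfold clear
  split_ifs with h <;> simp [h]

/-- This is why one pass suffices: an edge that was indispensable at its turn is still so after
further deletions. -/
theorem Violated.anti {N : ℕ} {A P H H' : ℕ → ℕ → ℕ} (h : Violated N A P H)
    (hH : ∀ u v, H' u v ≠ 0 → H u v ≠ 0) : Violated N A P H' := by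
  obtain ⟨a₁, h1, b₁, h2, a₂, h3, b₂, h4, s, h5, t, h6, h7, h8, h9⟩ := h
  exact ⟨a₁, h1, b₁, h2, a₂, h3, b₂, h4, s, h5, t, h6, h7, h8,
    fun hc => h9 (ReflTransGen.mono (fun u v huv => ⟨hH u v huv.1, huv.2⟩) _ _ hc)⟩

/-- `H` is a preserver of `A`, and its edges that come before `(a, b)` cannot be deleted. -/
structure DeleteInv (N : ℕ) (A P : ℕ → ℕ → ℕ) (a b : ℕ) (H : ℕ → ℕ → ℕ) : Prop where
  sub : ∀ u v, H u v ≠ 0 → A u v ≠ 0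
  ok : ¬ Violated N A P H
  crit : ∀ u v, v < N → u < a ∨ u = a ∧ v < b → H u v ≠ 0 → Violated N A P (clear H u v)

/-- Copy the array `0` into the array `2`. -/
def copy : Program :=
  forLoop 2 (forLoop 3 (.store 2 (.reg 2) (.reg 3) (.cell 0 (.reg 2) (.reg 3))))

/-- Delete the edge given by the registers `2` and `3` if this does not lead to a violation. -/
def tryDelete : Program :=
  .cond (.cell 2 (.reg 2) (.reg 3))
    (.seq (.store 2 (.reg 2) (.reg 3) (.const 0))
      (.seq check (.cond (.reg 13) (.store 2 (.reg 2) (.reg 3) (.const 1)) .skip)))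
    .skip

/-- Delete edges one after the other as long as there is no violation. -/
def reverseDelete : Program :=
  .seq (.assign 1 (.add (.reg 0) (.const 1))) (.seq copy (forLoop 2 (forLoop 3 tryDelete)))

/-- A bound for the number of steps of `tryDelete`. -/
def tryDeleteCost (N : ℕ) : ℕ := checkCost N + 40

/-- A bound for the number of steps of `reverseDelete`. -/
def reverseDeleteCost (N : ℕ) : ℕ :=
  10 + (forCost N (forCost N 10) + forCost N (forCost N (tryDeleteCost N)))

/-- The input of the algorithm: a graph in the array `0`, and pairs in the array `1`. -/
structure InputIn (N : ℕ) (A P : ℕ → ℕ → ℕ) (σ : State) : Prop where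
  bound : σ.reg 1 = N
  graph : σ.arr 0 = A
  pairs : σ.arr 1 = P

theorem InputIn.frame {N : ℕ} {A P : ℕ → ℕ → ℕ} {σ τ : State} {p : Program}
    (h : InputIn N A P σ) (hf : Frame p σ τ) (h1 : 1 ∉ p.regs) (h0 : ∀ a ∈ p.arrs, 2 ≤ a) :
    InputIn N A P τ :=
  ⟨(hf.reg 1 h1).trans h.bound,
    (hf.arr 0 fun hc => by have := h0 0 hc; omega).trans h.graph,
    (hf.arr 1 fun hc => by have := h0 1 hc; omega).trans h.pairs⟩

section Algorithm

variable {N : ℕ} {A P : ℕ → ℕ → ℕ} {σ : State}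

theorem runs_copy (hσ : InputIn N A P σ) (hA : ∀ u v, A u v ≠ 0 → u < N ∧ v < N)
    (h2 : ∀ u v, σ.arr 2 u v = 0) :
    Runs copy σ (forCost N (forCost N 10)) fun τ => ∀ u v, τ.arr 2 u v ≠ 0 ↔ A u v ≠ 0 := by
  let J : ℕ → ℕ → State → Prop := fun i j τ => ∀ u v, τ.arr 2 u v ≠ 0 ↔
    A u v ≠ 0 ∧ (u < i ∨ u = i ∧ v < j)
  refine (Runs.forLoop (N := N) hσ.bound (by decide) (by decide) (fun i τ => J i 0 τ) ?_
    ?_).weaken le_rfl fun τ _ h u v => ?_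
  · intro u v
    simp [setReg_arr, h2]
  · intro i hi τ hτ hτi hfr
    have hτ' : InputIn N A P τ := hσ.frame hfr (by decide) (by decide)
    refine (Runs.forLoop (N := N) hτ'.bound (by decide) (by decide) (fun j ρ => J i j ρ) hτ
      ?_).weaken le_rfl fun ρ _ h u v => ?_
    · intro j hj ρ hρ hρj hfr'
      refine Runs.store (fun u v => ?_) (by simp [Expr.cost])
      have e0 : ρ.arr 0 = A := (hτ'.frame hfr' (by decide) (by decide)).graph
      have e2 : ρ.reg 2 = i := (hfr'.reg 2 (by decide)).trans hτi
      have := hρ u v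
      simp only [setReg_arr, State.setCell, Expr.eval, e0, e2, hρj, true_and]
      split_ifs with huv
      · obtain ⟨rfl, rfl⟩ := huv
        simp
      · rw [this]
        refine and_congr_right fun _ => ?_
        omega
    · rw [setReg_arr, h u v]
      refine and_congr_right fun huv => ?_
      have := (hA u v huv).2
      omega
  · rw [h u v]
    exact ⟨fun h => h.1, fun huv => ⟨huv, Or.inl (hA u v huv).1⟩⟩

theorem runs_tryDelete (hσ : InputIn N A P σ) (hA : ∀ u v, A u v ≠ 0 → u < N ∧ v < N) {a b : ℕ}
    (ha : σ.reg 2 = a) (hb : σ.reg 3 = b) (hinv : DeleteInv N A P a b (σ.arr 2)) :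
    Runs tryDelete σ (tryDeleteCost N) fun τ => DeleteInv N A P a (b + 1) (τ.arr 2) := by
  refine Runs.cond (B := checkCost N + 30) (fun hab => ?_) (fun hab => ?_)
    (by simp only [Expr.cost, tryDeleteCost]; omega)
  · have hab' : σ.arr 2 a b ≠ 0 := by simpa [Expr.eval, ha, hb] using hab
    refine Runs.seq (B := 4) (C := checkCost N + 20)
      (Q := fun τ => τ = σ.setCell 2 a b 0) (Runs.store (by simp [Expr.eval, ha, hb])
      (by simp [Expr.cost])) (fun τ _ hτ => ?_) (by omega)
    have e2 : τ.arr 2 = clear (σ.arr 2) a b := by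
      subst hτ
      funext k l
      simp [State.setCell, clear]
    have hτi : InputIn N A P τ := by
      subst hτ
      exact ⟨hσ.bound, by rw [← hσ.graph]; funext k l; simp [State.setCell],
        by rw [← hσ.pairs]; funext k l; simp [State.setCell]⟩
    have hτB : Bounded N τ := by
      refine ⟨hτi.bound, by rw [hτi.graph]; exact hA, fun u v huv => ?_⟩
      rw [e2, clear_ne_zero] at huv
      exact hA u v (hinv.sub u v huv.2)
    refine Runs.seq (C := 10) (runs_check hτB) (fun ρ hρ h13 => ?_) (by omega)
    have e2' : ρ.arr 2 = clear (σ.arr 2) a b := (hρ.arr 2 (by decide)).trans e2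
    have ea : ρ.reg 2 = a := (hρ.reg 2 (by decide)).trans (by rw [hτ]; exact ha)
    have eb : ρ.reg 3 = b := (hρ.reg 3 (by decide)).trans (by rw [hτ]; exact hb)
    rw [e2, hτi.graph, hτi.pairs] at h13
    refine Runs.cond (B := 8) (fun h => ?_) (fun h => ?_) (by simp [Expr.cost])
    · have hviol := h13.1 h
      refine Runs.store ?_ (by simp [Expr.cost])
      -- The restored entry is `1`, whatever nonzero value was there before; only the supports of
      -- the matrices need to agree.
      have hsupp : ∀ u v, (ρ.setCell 2 ((Expr.reg 2).eval ρ) ((Expr.reg 3).eval ρ)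
          ((Expr.const 1).eval ρ)).arr 2 u v ≠ 0 ↔ σ.arr 2 u v ≠ 0 := by
        intro u v
        simp only [State.setCell, Expr.eval, ea, eb, e2', true_and]
        split_ifs with huv
        · obtain ⟨rfl, rfl⟩ := huv
          simp [hab']
        · rw [clear_ne_zero]
          exact and_iff_right huv
      refine ⟨fun u v huv => hinv.sub u v ((hsupp u v).1 huv),
        fun hc => hinv.ok (hc.anti fun u v huv => (hsupp u v).2 huv), fun u v hv huv huv' => ?_⟩
      have hcl : Violated N A P (clear (σ.arr 2) u v) := by
        by_cases hc : u = a ∧ v = b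
        · obtain ⟨rfl, rfl⟩ := hc
          exact hviol
        · exact hinv.crit u v hv (by omega) ((hsupp u v).1 huv')
      refine hcl.anti fun k l hkl => ?_
      rw [clear_ne_zero] at hkl ⊢
      exact ⟨hkl.1, (hsupp k l).1 hkl.2⟩
    · have hviol : ¬ Violated N A P (clear (σ.arr 2) a b) := fun hc => h13.2 hc h
      refine Runs.skip ?_ (by norm_num)
      rw [e2']
      refine ⟨fun u v huv => hinv.sub u v (clear_ne_zero.1 huv).2, hviol,
        fun u v hv huv huv' => ?_⟩
      rw [clear_ne_zero] at huv'
      refine (hinv.crit u v hv (by omega) huv'.2).anti fun k l hkl => ?_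
      rw [clear_ne_zero, clear_ne_zero] at hkl
      exact clear_ne_zero.2 ⟨hkl.1, hkl.2.2⟩
  · have hab' : σ.arr 2 a b = 0 := by simpa [Expr.eval, ha, hb] using hab
    refine Runs.skip ⟨hinv.sub, hinv.ok, fun u v hv huv huv' => ?_⟩ (by omega)
    by_cases hc : u = a ∧ v = b
    · obtain ⟨rfl, rfl⟩ := hc
      exact absurd hab' huv'
    · exact hinv.crit u v hv (by omega) huv'

theorem runs_reverseDelete (hσ1 : σ.reg 0 + 1 = N) (hσ2 : ∀ u v, σ.arr 2 u v = 0)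
    (hA : ∀ u v, σ.arr 0 u v ≠ 0 → u < N ∧ v < N) :
    Runs reverseDelete σ (reverseDeleteCost N) fun τ =>
      DeleteInv N (σ.arr 0) (σ.arr 1) N 0 (τ.arr 2) := by
  refine Runs.seq (B := 10) (Q := fun τ => τ = σ.setReg 1 N)
    (Runs.assign (by simp [Expr.eval, hσ1]) (by simp [Expr.cost])) (fun τ _ hτ => ?_) le_rfl
  subst hτ
  have hin : InputIn N (σ.arr 0) (σ.arr 1) (σ.setReg 1 N) := ⟨setReg_reg_self, rfl, rfl⟩
  refine Runs.seq (runs_copy hin hA hσ2) (fun τ hτ h2 => ?_) le_rfl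
  have hin' : InputIn N (σ.arr 0) (σ.arr 1) τ := hin.frame hτ (by decide) (by decide)
  refine Runs.forLoop hin'.bound (by decide) (by decide)
    (fun i τ => DeleteInv N (σ.arr 0) (σ.arr 1) i 0 (τ.arr 2)) ⟨?_, ?_, by simp⟩ ?_
  · exact fun u v => (h2 u v).1
  -- The copy has the same edges as the input graph, so nothing is violated at the start.
  · rintro ⟨a₁, -, b₁, -, a₂, -, b₂, -, s, -, t, -, -, h8, h9⟩
    exact h9 (ReflTransGen.mono (fun u v huv => ⟨(h2 u v).2 huv.1, huv.2⟩) _ _ h8)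
  · intro i hi ρ hρ hρi hfr
    have hin'' : InputIn N (σ.arr 0) (σ.arr 1) ρ := hin'.frame hfr (by decide) (by decide)
    refine (Runs.forLoop (N := N) hin''.bound (by decide) (by decide)
      (fun j τ => DeleteInv N (σ.arr 0) (σ.arr 1) i j (τ.arr 2)) hρ ?_).weaken le_rfl
      fun θ _ h => ⟨h.sub, h.ok, fun u v hv huv => h.crit u v hv (by omega)⟩
    intro j hj θ hθ hθj hfr'
    exact runs_tryDelete (hin''.frame hfr' (by decide) (by decide)) hA
      ((hfr'.reg 2 (by decide)).trans hρi) hθj hθ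

end Algorithm

/-- The values of `f` are those of a polynomial. -/
def IsPoly (f : ℕ → ℕ) : Prop := ∃ p : Polynomial ℕ, ∀ n, p.eval n = f n

theorem IsPoly.const (c : ℕ) : IsPoly fun _ => c := ⟨Polynomial.C c, by simp⟩

theorem IsPoly.add {f g : ℕ → ℕ} (hf : IsPoly f) (hg : IsPoly g) : IsPoly fun n => f n + g n := by
  obtain ⟨p, hp⟩ := hf
  obtain ⟨q, hq⟩ := hg
  exact ⟨p + q, by simp [hp, hq]⟩

theorem IsPoly.forCost {f : ℕ → ℕ} (hf : IsPoly f) : IsPoly fun n => forCost (n + 1) (f n) := by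
  obtain ⟨p, hp⟩ := hf
  exact ⟨(Polynomial.X + 1) * (p + 8) + 6, by simp [hp, RAM.forCost]⟩

theorem isPoly_reverseDeleteCost : IsPoly fun n => reverseDeleteCost (n + 1) := by
  have h100 := (IsPoly.const 100).forCost
  have hcl : IsPoly fun n => closureCost (n + 1) :=
    (IsPoly.const 10).forCost.add h100.forCost.forCost
  have hsc : IsPoly fun n => scanCost (n + 1) := hcl.add (hcl.add h100)
  have hch : IsPoly fun n => checkCost (n + 1) :=
    (IsPoly.const 2).add hsc.forCost.forCost.forCost.forCost.forCost
  have htd : IsPoly fun n => tryDeleteCost (n + 1) := hch.add (IsPoly.const 40)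
  exact (IsPoly.const 10).add
    ((IsPoly.const 10).forCost.forCost.add htd.forCost.forCost)

end RAM

/-! ### Matrices versus digraphs, and the correctness of the output. -/

section Matrices

open Relation RAM

/-- The matrix `A` is an adjacency matrix of `G`. -/
def IsMatrix {n : ℕ} (A : ℕ → ℕ → ℕ) (G : Digraph (Fin n)) : Prop :=
  ∀ u v, A u v ≠ 0 ↔ ∃ (hu : u < n) (hv : v < n), G.Adj ⟨u, hu⟩ ⟨v, hv⟩

theorem reflTransGen_iff_fin {n : ℕ} {r : ℕ → ℕ → Prop} {R : Fin n → Fin n → Prop}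
    (h : ∀ u v, r u v ↔ ∃ (hu : u < n) (hv : v < n), R ⟨u, hu⟩ ⟨v, hv⟩) (s t : Fin n) :
    ReflTransGen r s t ↔ ReflTransGen R s t := by
  constructor
  · intro hst
    have : ∀ v, ReflTransGen r s v → ∃ hv : v < n, ReflTransGen R s ⟨v, hv⟩ := by
      intro v hv
      induction hv with
      | refl => exact ⟨s.2, ReflTransGen.refl⟩
      | tail _ hbc ih =>
        obtain ⟨hb, ih⟩ := ih
        obtain ⟨_, hc, hR⟩ := (h _ _).1 hbc
        exact ⟨hc, ih.tail hR⟩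
    exact (this t hst).2
  · intro hst
    exact hst.lift (fun i : Fin n => (i : ℕ)) fun u v huv => (h u v).2 ⟨u.2, v.2, huv⟩

/-- The four numbers need to describe `F` only on edges of `H`, since deleting anything else has no
effect. So they may code pairs that are not edges, or not even pairs of vertices. -/
theorem reflTransGen_aliveRel_iff {n : ℕ} {A : ℕ → ℕ → ℕ} {H : Digraph (Fin n)} (hA : IsMatrix A H)
    {F : Set (Fin n × Fin n)} {a₁ b₁ a₂ b₂ : ℕ}
    (hF : ∀ u v : Fin n, H.Adj u v →
      ((u, v) ∈ F ↔ ((u : ℕ) = a₁ ∧ (v : ℕ) = b₁) ∨ ((u : ℕ) = a₂ ∧ (v : ℕ) = b₂)))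
    (s t : Fin n) :
    ReflTransGen (aliveRel A a₁ b₁ a₂ b₂) s t ↔ Reachable (deleteEdges H F) s t := by
  refine reflTransGen_iff_fin (fun u v => ?_) s t
  constructor
  · rintro ⟨h, h1, h2⟩
    obtain ⟨hu, hv, hadj⟩ := (hA u v).1 h
    exact ⟨hu, hv, hadj, fun hc => ((hF _ _ hadj).1 hc).elim h1 h2⟩
  · rintro ⟨hu, hv, hadj, hn⟩
    refine ⟨(hA u v).2 ⟨hu, hv, hadj⟩, fun hc => ?_, fun hc => ?_⟩
    · exact hn ((hF _ _ hadj).2 (Or.inl hc))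
    · exact hn ((hF _ _ hadj).2 (Or.inr hc))

theorem isFTRS_of_not_violated {n : ℕ} {G H : Digraph (Fin n)} {P : Finset (Fin n × Fin n)}
    {A B Q : ℕ → ℕ → ℕ} (hA : IsMatrix A G) (hB : IsMatrix B H) (hHG : H ≤ G)
    (hQ : ∀ s t : Fin n, (s, t) ∈ P → Q s t ≠ 0) (h : ¬ Violated (n + 1) A Q B) :
    IsFTRS 2 G P H := by
  refine ⟨hHG, fun s t hst F hFG hF => ⟨fun hr => ?_, ?_⟩⟩
  · obtain ⟨a₁, h1, b₁, h2, a₂, h3, b₂, h4, hcode⟩ : ∃ a₁ < n + 1, ∃ b₁ < n + 1, ∃ a₂ < n + 1,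
        ∃ b₂ < n + 1, ∀ u v : Fin n, (u, v) ∈ F ↔
          ((u : ℕ) = a₁ ∧ (v : ℕ) = b₁) ∨ ((u : ℕ) = a₂ ∧ (v : ℕ) = b₂) := by
      have hlt : ∀ x : Fin n, (x : ℕ) < n + 1 := fun x => by have := x.2; omega
      have hcase : F.card = 0 ∨ F.card = 1 ∨ F.card = 2 := by omega
      rcases hcase with h | h | h
      · rw [Finset.card_eq_zero] at h
        subst h
        -- The number `n` is not a vertex, so `(n, n)` codes an absent fault; this is why the loops
        -- run below `n + 1`. A single fault is coded by repeating it.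
        refine ⟨n, by omega, n, by omega, n, by omega, n, by omega, fun u v => ?_⟩
        have := u.2
        simp only [Finset.notMem_empty, false_iff]
        omega
      · obtain ⟨⟨x, y⟩, rfl⟩ := Finset.card_eq_one.1 h
        refine ⟨x, hlt x, y, hlt y, x, hlt x, y, hlt y, fun u v => ?_⟩
        simp [Fin.ext_iff]
      · obtain ⟨⟨x, y⟩, ⟨z, w⟩, -, rfl⟩ := Finset.card_eq_two.1 h
        refine ⟨x, hlt x, y, hlt y, z, hlt z, w, hlt w, fun u v => ?_⟩
        simp [Fin.ext_iff]
    by_contra hc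
    refine h ⟨a₁, h1, b₁, h2, a₂, h3, b₂, h4, s, by omega, t, by omega, hQ s t hst, ?_, ?_⟩
    · exact (reflTransGen_aliveRel_iff hA (F := F) (fun u v _ => hcode u v) s t).2 hr
    · rwa [reflTransGen_aliveRel_iff hB (F := F) (fun u v _ => hcode u v) s t]
  · exact Reachable.mono (H := deleteEdges H F) (G := deleteEdges G F)
      fun u v huv => ⟨hHG huv.1, huv.2⟩

theorem not_isFTRS_of_violated {n : ℕ} {G H : Digraph (Fin n)} {P : Finset (Fin n × Fin n)}
    {A B Q : ℕ → ℕ → ℕ} (hA : IsMatrix A G) (hB : IsMatrix B H) (hHG : H ≤ G)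
    (hQ : ∀ s t : ℕ, Q s t ≠ 0 → ∃ (hs : s < n) (ht : t < n), (⟨s, hs⟩, ⟨t, ht⟩) ∈ P)
    (h : Violated (n + 1) A Q B) : ¬ IsFTRS 2 G P H := by
  classical
  intro hH
  obtain ⟨a₁, -, b₁, -, a₂, -, b₂, -, s, -, t, -, hst, h1, h2⟩ := h
  obtain ⟨hs, ht, hst⟩ := hQ s t hst
  -- Faults have to be edges of `G`, so the coded pairs that are not edges of `G` are dropped; as `H
  -- ≤ G`, this changes neither graph after the deletion.
  let F : Finset (Fin n × Fin n) := Finset.univ.filter fun e => G.Adj e.1 e.2 ∧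
    (((e.1 : ℕ) = a₁ ∧ (e.2 : ℕ) = b₁) ∨ ((e.1 : ℕ) = a₂ ∧ (e.2 : ℕ) = b₂))
  have hcard : F.card ≤ 2 := by
    refine (Finset.card_le_card_of_injOn (t := {(a₁, b₁), (a₂, b₂)})
      (fun e : Fin n × Fin n => ((e.1 : ℕ), (e.2 : ℕ))) (fun e he => ?_) ?_).trans
      Finset.card_le_two
    · have := (Finset.mem_filter.1 he).2.2
      simpa [Prod.ext_iff] using this
    · rintro ⟨x, y⟩ - ⟨z, w⟩ - hxy
      simpa [Fin.ext_iff] using hxy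
  have hF : ∀ u v : Fin n, G.Adj u v → ((u, v) ∈ (F : Set (Fin n × Fin n)) ↔
      ((u : ℕ) = a₁ ∧ (v : ℕ) = b₁) ∨ ((u : ℕ) = a₂ ∧ (v : ℕ) = b₂)) := by
    intro u v huv
    simp [F, huv]
  have hiff := hH.2 ⟨s, hs⟩ ⟨t, ht⟩ hst F (fun e he => by
    have he' : e ∈ F := he
    exact (Finset.mem_filter.1 he').2.1) hcard
  rw [← reflTransGen_aliveRel_iff hA hF,
    ← reflTransGen_aliveRel_iff hB fun u v huv => hF u v (hHG huv)] at hiff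
  exact h2 (hiff.1 h1)

/-- The program `reverseDelete` turns the input into a minimal preserver. -/
theorem exec_reverseDelete {n : ℕ} (G : Digraph (Fin n)) (P : Finset (Fin n × Fin n)) :
    ∃ T σ, Exec reverseDelete (inputState G P) T σ ∧ T ≤ reverseDeleteCost (n + 1) ∧
      IsFTRS 2 G P (outputGraph n σ) ∧
      ∀ e ∈ edges (outputGraph n σ), ¬ IsFTRS 2 G P (deleteEdges (outputGraph n σ) {e}) := by
  have hA : IsMatrix ((inputState G P).arr 0) G := by
    intro u v
    by_cases h : u < n ∧ v < n
    · simp [inputState, h]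
    · simp only [inputState, h, dif_neg, not_false_eq_true, ne_eq, not_true_eq_false, false_iff]
      rintro ⟨hu, hv, -⟩
      exact h ⟨hu, hv⟩
  have hQ : ∀ s t : ℕ, (inputState G P).arr 1 s t ≠ 0 ↔
      ∃ (hs : s < n) (ht : t < n), (⟨s, hs⟩, ⟨t, ht⟩) ∈ P := by
    intro u v
    by_cases h : u < n ∧ v < n
    · simp [inputState, h]
    · simp only [inputState, h, dif_neg, not_false_eq_true, ne_eq, not_true_eq_false, false_iff]
      rintro ⟨hu, hv, -⟩
      exact h ⟨hu, hv⟩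
  obtain ⟨T, σ, h1, h2, h3⟩ := runs_reverseDelete (σ := inputState G P) (N := n + 1) rfl
    (fun u v => by simp [inputState]) (fun u v huv => by
      obtain ⟨hu, hv, -⟩ := (hA u v).1 huv
      omega)
  have hB : IsMatrix (σ.arr 2) (outputGraph n σ) := by
    intro u v
    refine ⟨fun h => ?_, fun ⟨_, _, h⟩ => h⟩
    obtain ⟨hu, hv, -⟩ := (hA u v).1 (h3.sub u v h)
    exact ⟨hu, hv, h⟩
  have hle : outputGraph n σ ≤ G := fun u v huv => by
    obtain ⟨_, _, h⟩ := (hA u v).1 (h3.sub u v huv)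
    exact h
  refine ⟨T, σ, h1, h2, isFTRS_of_not_violated hA hB hle
    (fun s t hst => (hQ s t).2 ⟨s.2, t.2, hst⟩) h3.ok, ?_⟩
  rintro ⟨u, v⟩ huv
  refine not_isFTRS_of_violated (B := clear (σ.arr 2) u v) hA ?_
    (fun a b hab => hle hab.1) (fun s t => (hQ s t).1)
    (h3.crit u v (by omega) (Or.inl (by omega)) huv)
  intro k l
  rw [clear_ne_zero, hB k l]
  constructor
  · rintro ⟨hkl, hk, hl, h⟩
    refine ⟨hk, hl, h, fun hc => hkl ?_⟩
    simpa [Fin.ext_iff] using hc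
  · rintro ⟨hk, hl, h, hc⟩
    exact ⟨fun hkl => hc (by simpa [Fin.ext_iff] using hkl), hk, hl, h⟩

end Matrices

end FTRS

theorem theorem5 :
    ∃ C : ℝ,
      (∀ (V : Type*) [Fintype V] (G : Digraph V) (P : Finset (V × V)),
        ∃ H : Digraph V, FTRS.IsFTRS 2 G P H ∧
          ((FTRS.edges H).ncard : ℝ) ≤
            C * (Fintype.card V : ℝ) ^ (4 / 3 : ℝ) * (P.card : ℝ) ^ (1 / 3 : ℝ)) ∧
      (∃ (A : FTRS.RAM.Program) (p : Polynomial ℕ),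
        ∀ (n : ℕ) (G : Digraph (Fin n)) (P : Finset (Fin n × Fin n)),
          ∃ (T : ℕ) (σ : FTRS.RAM.State),
            FTRS.RAM.Exec A (FTRS.inputState G P) T σ ∧ T ≤ p.eval n ∧
            FTRS.IsFTRS 2 G P (FTRS.outputGraph n σ) ∧
            ((FTRS.edges (FTRS.outputGraph n σ)).ncard : ℝ) ≤
              C * (n : ℝ) ^ (4 / 3 : ℝ) * (P.card : ℝ) ^ (1 / 3 : ℝ)) := by
  refine ⟨326, fun V _ G P => FTRS.exists_isFTRS_ncard_edges_le G P, FTRS.RAM.reverseDelete, ?_⟩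
  obtain ⟨p, hp⟩ := FTRS.RAM.isPoly_reverseDeleteCost
  refine ⟨p, fun n G P => ?_⟩
  obtain ⟨T, σ, h1, h2, h3, h4⟩ := FTRS.exec_reverseDelete G P
  refine ⟨T, σ, h1, h2.trans (hp n).ge, h3, ?_⟩
  simpa using FTRS.ncard_edges_le_of_minimal h3 h4
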